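/- For a positive integer $r$, an $r$-uniform graph ($r$-graph) $G$ consists of a finite vertex set $V(G)$ and a set $E(G)$ of $r$-element subsets of $V(G)$. Its Lagrangian is $$\lambda(G)=\max\Big\{\sum_{e\in E(G)}\prod_{i\in e}x_i \;:\; x_i\ge 0 \text{ for } i\in V(G),\ \sum_{i\in V(G)}x_i=1\Big\}.$$ For distinct $r$-element sets $A,B$ of positive integers, $A$ precedes $B$ in the colex ordering if $\max(A\triangle B)\in B$. For $m\le\binom{t}{r}$ let $C_{r,m}$ be the $r$-graph on the vertex set $\{1,\dots,t\}$ whose edges are the first $m$ sets in the colex ordering of the $r$-element sets of positive integers (all of these are subsets of $\{1,\dots,t\}$). Theorem 1.9. Let $r,m,t$ be positive integers with $m=\binom{t}{r}-4$, and suppose that $t\ne r+2$ if $r\ge 4$. Then $C_{r,m}$ has the largest Lagrangian of all $r$-graphs with $m$ edges and $t$ vertices: $C_{r,m}$ is an $r$-graph with $t$ vertices and $m$ edges, and $\lambda(G)\le\lambda(C_{r,m})$ for every $r$-graph $G$ with $t$ vertices and $m$ edges. -/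

import Mathlib

open Finset

/-- An `r`-uniform graph: a finite set of vertices (taken from a type `α`) together with a set of
edges, each of which is an `r`-element set of vertices. -/
structure RGraph (α : Type*) (r : ℕ) where
  verts : Finset α
  edges : Finset (Finset α)
  edges_subset : edges ⊆ verts.powersetCard r

namespace RGraph

variable {α : Type*} {r : ℕ}

/-- `lagrangePoly G x = ∑_{e ∈ E(G)} ∏_{i ∈ e} x_i`. -/
def lagrangePoly (G : RGraph α r) (x : α → ℝ) : ℝ :=
  ∑ e ∈ G.edges, ∏ i ∈ e, x i

/-- A legal weighting: nonnegative weights on the vertices with total weight one. (The values of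
`x` outside the vertex set are irrelevant, also for `lagrangePoly`.) -/
def IsLegal (G : RGraph α r) (x : α → ℝ) : Prop :=
  (∀ i ∈ G.verts, 0 ≤ x i) ∧ ∑ i ∈ G.verts, x i = 1

/-- The Lagrangian of `G`, the maximum of `lagrangePoly G x` over all legal weightings `x`.
It is attained if there is a vertex, see `isGreatest_lagrangian`. -/
noncomputable def lagrangian (G : RGraph α r) : ℝ :=
  sSup {l : ℝ | ∃ x : α → ℝ, G.IsLegal x ∧ G.lagrangePoly x = l}

theorem isGreatest_lagrangian (G : RGraph α r) (hG : G.verts.Nonempty) :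
    IsGreatest {l : ℝ | ∃ x : α → ℝ, G.IsLegal x ∧ G.lagrangePoly x = l} G.lagrangian := by
  classical
  let ext : (G.verts → ℝ) → α → ℝ := fun y a => if h : a ∈ G.verts then y ⟨a, h⟩ else 0
  have hcont : Continuous fun y : G.verts → ℝ => G.lagrangePoly (ext y) := by
    unfold lagrangePoly
    refine continuous_finsetSum _ fun e _ => continuous_finsetProd _ fun i _ => ?_
    by_cases h : i ∈ G.verts
    · simpa [ext, h] using continuous_apply _
    · simpa [ext, h] using continuous_const
  have hset : {l : ℝ | ∃ x : α → ℝ, G.IsLegal x ∧ G.lagrangePoly x = l} =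
      (fun y : G.verts → ℝ => G.lagrangePoly (ext y)) '' stdSimplex ℝ G.verts := by
    ext l
    constructor
    · rintro ⟨x, ⟨hx0, hx1⟩, rfl⟩
      refine ⟨fun i => x i, ⟨fun i => hx0 i i.2, ?_⟩, ?_⟩
      · rw [← hx1]
        exact Finset.sum_coe_sort G.verts x
      · refine Finset.sum_congr rfl fun e he => Finset.prod_congr rfl fun i hi => ?_
        have : i ∈ G.verts := (Finset.mem_powersetCard.1 (G.edges_subset he)).1 hi
        simp [ext, this]
    · rintro ⟨y, ⟨hy0, hy1⟩, rfl⟩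
      refine ⟨ext y, ⟨fun i hi => ?_, ?_⟩, rfl⟩
      · simpa [ext, hi] using hy0 ⟨i, hi⟩
      · rw [← hy1, ← Finset.sum_coe_sort G.verts]
        exact Finset.sum_congr rfl fun i _ => by simp [ext]
  have hne : (stdSimplex ℝ G.verts).Nonempty := by
    obtain ⟨v, hv⟩ := hG
    exact ⟨_, single_mem_stdSimplex ℝ (⟨v, hv⟩ : G.verts)⟩
  unfold lagrangian
  rw [hset]
  exact ((isCompact_stdSimplex ℝ G.verts).image hcont).isGreatest_sSup (hne.image _)

end RGraph

/-- The `r`-element sets of positive integers. -/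
def posSubsets (r : ℕ) : Set (Finset ℕ) :=
  {A | A.card = r ∧ ∀ a ∈ A, 1 ≤ a}

/-- The first `m` sets in the colex ordering of the `r`-element sets of positive integers: those
with fewer than `m` predecessors. -/
def colexFirst (r m : ℕ) : Set (Finset ℕ) :=
  {A | A ∈ posSubsets r ∧ {B | B ∈ posSubsets r ∧ toColex B < toColex A}.encard < m}

theorem posSubsets_pred {r n : ℕ} {A B : Finset ℕ} (hA : A ∈ (Icc 1 n).powersetCard r)
    (hB : B ∈ posSubsets r) (h : toColex B < toColex A) : B ∈ (Icc 1 n).powersetCard r := by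
  rw [mem_powersetCard] at hA ⊢
  refine ⟨fun b hb => mem_Icc.2 ⟨hB.2 b hb, ?_⟩, hB.1⟩
  exact Colex.forall_le_mono h.le (fun a ha => (mem_Icc.1 (hA.1 ha)).2) b hb

theorem powersetCard_subset_posSubsets {r n : ℕ} {A : Finset ℕ}
    (hA : A ∈ (Icc 1 n).powersetCard r) : A ∈ posSubsets r := by
  rw [mem_powersetCard] at hA
  exact ⟨hA.2, fun a ha => (mem_Icc.1 (hA.1 ha)).1⟩

/-- The first `m ≤ n.choose r` sets in colex are subsets of `{1, …, n}`. -/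
theorem colexFirst_subset {r m n : ℕ} (h : m ≤ n.choose r) :
    colexFirst r m ⊆ ((Icc 1 n).powersetCard r : Finset (Finset ℕ)) := by
  rintro A ⟨hA, hlt⟩
  by_contra hAn
  have hbig : ∃ a ∈ A, n < a := by
    by_contra hcon
    push Not at hcon
    exact hAn (mem_coe.2 (mem_powersetCard.2
      ⟨fun a ha => mem_Icc.2 ⟨hA.2 a ha, hcon a ha⟩, hA.1⟩))
  obtain ⟨a, haA, hna⟩ := hbig
  have hsub : (((Icc 1 n).powersetCard r : Finset (Finset ℕ)) : Set (Finset ℕ)) ⊆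
      {B | B ∈ posSubsets r ∧ toColex B < toColex A} := by
    intro B hB
    refine ⟨powersetCard_subset_posSubsets hB, ?_⟩
    have hBn := (mem_powersetCard.1 (mem_coe.1 hB)).1
    rw [Colex.toColex_lt_toColex]
    refine ⟨fun hEq => ?_, fun b hb _ => ⟨a, haA, fun haB => ?_, ?_⟩⟩
    · have := (mem_Icc.1 (hBn (hEq ▸ haA))).2
      omega
    · have := (mem_Icc.1 (hBn haB)).2
      omega
    · have := (mem_Icc.1 (hBn hb)).2
      omega
  have hcard := Set.encard_le_encard hsub
  rw [Set.encard_coe_eq_coe_finsetCard, card_powersetCard, Nat.card_Icc,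
    Nat.add_sub_cancel] at hcard
  have hlt' := lt_of_le_of_lt hcard hlt
  exact absurd (Nat.cast_lt.1 hlt') (not_lt.2 h)

/-- The graph `C_{r,m}` on the vertex set `{1, …, n}` (where `m ≤ n.choose r`, so that it fits):
its edges are the first `m` sets in the colex ordering of the `r`-element sets of positive
integers. -/
noncomputable def colexGraph (r m n : ℕ) (h : m ≤ n.choose r) : RGraph ℕ r where
  verts := Icc 1 n
  edges := ((Finset.finite_toSet _).subset (colexFirst_subset h)).toFinset
  edges_subset := fun A hA => colexFirst_subset h (by simpa using hA)

theorem card_filter_card_lt {β : Type*} [LinearOrder β] (S : Finset β) :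
    ∀ m : ℕ, m ≤ S.card → (S.filter fun a => (S.filter (· < a)).card < m).card = m := by
  induction S using Finset.induction_on_max with
  | empty => intro m hm; simp at hm; simp [hm]
  | insert a S ha ih =>
    intro m hm
    have haS : a ∉ S := fun h => lt_irrefl _ (ha a h)
    rw [card_insert_of_notMem haS] at hm
    have h1 : ((insert a S).filter (· < a)) = S := by
      rw [filter_insert, if_neg (lt_irrefl a)]
      exact filter_true_of_mem ha
    have h2 : ∀ b ∈ S, ((insert a S).filter (· < b)) = S.filter (· < b) := by
      intro b hb
      rw [filter_insert, if_neg (ha b hb).not_gt]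
    have h3 : (S.filter fun b => ((insert a S).filter (· < b)).card < m) =
        S.filter fun b => (S.filter (· < b)).card < m :=
      filter_congr fun b hb => by rw [h2 b hb]
    rw [filter_insert, h1, h3]
    rcases Nat.lt_or_ge S.card m with hlt | hge
    · have hm' : m = S.card + 1 := by omega
      rw [if_pos hlt, card_insert_of_notMem fun h => haS (mem_filter.1 h).1,
        filter_true_of_mem fun b hb =>
          lt_of_le_of_lt (card_le_card (filter_subset _ _)) hlt, hm']
    · rw [if_neg (by omega), ih m hge]

theorem colexGraph_card_edges (r m n : ℕ) (h : m ≤ n.choose r) :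
    (colexGraph r m n h).edges.card = m := by
  classical
  set P := (Icc 1 n).powersetCard r with hP
  have hPcard : P.card = n.choose r := by simp [hP, card_powersetCard]
  have key := card_filter_card_lt (P.map toColex.toEmbedding) m (by rwa [card_map, hPcard])
  rw [filter_map, card_map] at key
  refine Eq.trans (congrArg Finset.card ?_) key
  ext A
  have hpred : A ∈ P → {B | B ∈ posSubsets r ∧ toColex B < toColex A}.encard =
      (((P.map toColex.toEmbedding).filter (· < toColex A)).card : ℕ∞) := by
    intro hA
    rw [filter_map, card_map, ← Set.encard_coe_eq_coe_finsetCard]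
    congr 1
    ext B
    simp only [Set.mem_ofPred_eq, coe_filter, Function.comp, Equiv.coe_toEmbedding]
    exact ⟨fun hB => ⟨posSubsets_pred hA hB.1 hB.2, hB.2⟩,
      fun hB => ⟨powersetCard_subset_posSubsets hB.1, hB.2⟩⟩
  simp only [colexGraph, Set.Finite.mem_toFinset, mem_filter, Function.comp,
    Equiv.coe_toEmbedding]
  constructor
  · intro hA
    have hAP : A ∈ P := colexFirst_subset h hA
    have h2 := hA.2
    rw [hpred hAP] at h2
    exact ⟨hAP, Nat.cast_lt.1 h2⟩
  · rintro ⟨hAP, hlt⟩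
    refine ⟨powersetCard_subset_posSubsets hAP, ?_⟩
    rw [hpred hAP]
    exact Nat.cast_lt.2 hlt

/-! ### Elementary symmetric functions as polynomial coefficients, and the inequalities at an
interior maximum. -/

section Generating
open Polynomial

/-! Exactly four `r`-sets are missing from the graph. Number the vertices 0, …, t-1 by increasing
weight: the value of the graph is then e_r(y) minus the weight of the missing sets, so that weight
has to be bounded below. Replacing elements by lighter ones (`SortedWeights.missing_le`) shows that
it is at least the weight of one of three families: a star (a common (r-1)-set extended by each of
four vertices), a paw (a common (r-2)-set extended by the edges of a triangle with a pendant edge),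
or a quadruple (the four r-subsets of an (r+1)-set that contain its r-3 lightest elements).

Reversing the labels sends light vertices to large numbers, and the last four r-sets in colex become
the star if t ≥ r+3, the paw if t = r+2, the quadruple if t = r+1. When the family found is this
one, the same weights prove the bound (`elemSymm_sub_starMissing_le` and its two analogues).

Otherwise the weights have to be changed. For t ≥ r+3, a paw or a quadruple must be traded for a
star. With r ≥ 3, fix all weights but six consecutive ones and maximise over these with their sum
fixed. If a weight vanishes at the maximum, moving it into the core of the star makes the star
weightless. If all are positive, the first-order conditions make an explicit change of weights
profitable: averaging two weights for the paw (`star_ge_of_triangle_pendant`), reflecting the six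
weights in their mean for the quadruple (`star_ge_of_quadruple`). For r = 2 the paw is handled by
merging two vertices that form a missing edge. What remains is the quadruple with t = r+2; the
restriction on `t` leaves only r = 3, t = 5, which is settled by explicit values. -/

/-- The linear factor `1 + a X` of a generating polynomial of elementary symmetric functions. -/
noncomputable def linFactor (a : ℝ) : ℝ[X] := 1 + C a * X

theorem coeff_mul_linFactor (G : ℝ[X]) (a : ℝ) (k : ℕ) :
    (G * linFactor a).coeff (k + 1) = G.coeff (k + 1) + a * G.coeff k := by
  rw [linFactor, mul_add, mul_one, coeff_add, ← mul_assoc, coeff_mul_X, mul_comm G,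
    coeff_C_mul]

theorem coeff_mul_linFactor_pair (H : ℝ[X]) (u v : ℝ) (k : ℕ) :
    (H * linFactor u * linFactor v).coeff (k + 2) =
      H.coeff (k + 2) + (u + v) * H.coeff (k + 1) + u * v * H.coeff k := by
  rw [coeff_mul_linFactor, coeff_mul_linFactor, coeff_mul_linFactor]
  ring

/-- All coefficients are nonnegative. -/
def CoeffNonneg (p : ℝ[X]) : Prop := ∀ k, 0 ≤ p.coeff k

theorem CoeffNonneg.mul {p q : ℝ[X]} (hp : CoeffNonneg p) (hq : CoeffNonneg q) :
    CoeffNonneg (p * q) := fun k => by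
  rw [coeff_mul]
  exact sum_nonneg fun i _ => mul_nonneg (hp _) (hq _)

theorem CoeffNonneg.add {p q : ℝ[X]} (hp : CoeffNonneg p) (hq : CoeffNonneg q) :
    CoeffNonneg (p + q) := fun k => by
  rw [coeff_add]
  exact add_nonneg (hp _) (hq _)

theorem coeffNonneg_one : CoeffNonneg (1 : ℝ[X]) := fun k => by
  rw [coeff_one]
  split_ifs <;> norm_num

theorem coeffNonneg_monomial {c : ℝ} (hc : 0 ≤ c) (j : ℕ) : CoeffNonneg (C c * X ^ j) :=
  fun k => by
  rw [coeff_C_mul_X_pow]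
  split_ifs <;> simp [hc]

theorem coeffNonneg_linFactor {a : ℝ} (ha : 0 ≤ a) : CoeffNonneg (linFactor a) := by
  simpa [linFactor] using coeffNonneg_one.add (coeffNonneg_monomial ha 1)

theorem CoeffNonneg.mul_linFactor {G : ℝ[X]} (hG : CoeffNonneg G) {a : ℝ} (ha : 0 ≤ a) :
    CoeffNonneg (G * linFactor a) :=
  hG.mul (coeffNonneg_linFactor ha)

theorem CoeffNonneg.le_coeff_mul_linFactor {G : ℝ[X]} (hG : CoeffNonneg G) {a : ℝ} (ha : 0 ≤ a)
    (k : ℕ) : G.coeff k ≤ (G * linFactor a).coeff k := by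
  rcases k with _ | k
  · simp [linFactor, mul_add, coeff_zero_eq_eval_zero]
  · rw [coeff_mul_linFactor]
    have := mul_nonneg ha (hG k)
    linarith

/-- Take degree 1 from one of the four linear factors and degree `n` from `G`. This lower bound
keeps the coefficients in the first-order conditions positive. -/
theorem CoeffNonneg.le_coeff_succ_mul_four {G : ℝ[X]} (hG : CoeffNonneg G) {a b c d P : ℝ}
    (ha : 0 ≤ a) (hb : 0 ≤ b) (hc : 0 ≤ c) (hd : 0 ≤ d) {n : ℕ} (hP : P ≤ G.coeff n) :
    (a + b + c + d) * P ≤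
      (G * linFactor a * linFactor b * linFactor c * linFactor d).coeff (n + 1) := by
  have h1 := hG.le_coeff_mul_linFactor ha n
  have hGa := hG.mul_linFactor ha
  have h2 := hGa.le_coeff_mul_linFactor hb n
  have hGb := hGa.mul_linFactor hb
  have h3 := hGb.le_coeff_mul_linFactor hc n
  simp only [coeff_mul_linFactor]
  have := hG (n + 1)
  have e1 := mul_le_mul_of_nonneg_left hP ha
  have e2 := mul_le_mul_of_nonneg_left (hP.trans h1) hb
  have e3 := mul_le_mul_of_nonneg_left (hP.trans (h1.trans h2)) hc
  have e4 := mul_le_mul_of_nonneg_left (hP.trans (h1.trans (h2.trans h3))) hd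
  linarith

theorem eq_zero_of_forall_mul_sub_sq_nonpos {u v β γ : ℝ} (hu : 0 < u) (hv : 0 < v)
    (h : ∀ δ, -u ≤ δ → δ ≤ v → δ * β - δ ^ 2 * γ ≤ 0) : β = 0 := by
  by_contra hβ
  set c := min u v with hc
  have hc0 : 0 < c := lt_min hu hv
  have hcu : c ≤ u := min_le_left _ _
  have hcv : c ≤ v := min_le_right _ _
  -- The test point is δ = ρβ: this `ρ` gives |δ| ≤ min u v, and ρ|γ| < 1 lets the linear term win.
  set ρ := c / (c * |γ| + |β|) with hρ
  have hβ0 : 0 < |β| := abs_pos.2 hβ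
  have hden : 0 < c * |γ| + |β| := by positivity
  have hρ0 : 0 < ρ := div_pos hc0 hden
  have hρe : ρ * (c * |γ| + |β|) = c := div_mul_cancel₀ _ hden.ne'
  have hρβ : ρ * |β| ≤ c := by
    have : 0 ≤ ρ * (c * |γ|) := by positivity
    linarith
  have hργ : ρ * |γ| < 1 := by
    have : 0 < ρ * |β| := by positivity
    have h2 : c * (ρ * |γ|) < c * 1 := by linarith
    exact lt_of_mul_lt_mul_left h2 hc0.le
  have habs : |ρ * β| ≤ c := by rwa [abs_mul, abs_of_pos hρ0]
  have hb := abs_le.1 habs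
  have := h (ρ * β) (by linarith) (by linarith)
  have hγ := le_abs_self γ
  have hs : 0 < ρ * β ^ 2 := by positivity
  have h3 : ρ * β ^ 2 * (1 - ρ * γ) ≤ 0 := by linarith
  have h4 : ρ * γ ≤ ρ * |γ| := mul_le_mul_of_nonneg_left hγ hρ0.le
  have : 0 < ρ * β ^ 2 * (1 - ρ * γ) := mul_pos hs (by linarith)
  linarith

/-- First order condition for moving weight between two vertices of weights `u`, `v`. -/
theorem stationary_pair {H : ℝ[X]} {k : ℕ} {u v β γ κ c : ℝ} (hu : 0 < u) (hv : 0 < v)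
    (hmax : ∀ u' v', 0 ≤ u' → 0 ≤ v' → u' + v' = u + v →
      (H * linFactor u' * linFactor v').coeff (k + 2) - (c + β * u' + γ * v' + κ * u' * v') ≤
        (H * linFactor u * linFactor v).coeff (k + 2) - (c + β * u + γ * v + κ * u * v)) :
    (v - u) * (H.coeff k - κ) = β - γ := by
  -- Passing to (u + δ, v - δ) fixes u + v and changes uv by δ(v - u) - δ².
  have := eq_zero_of_forall_mul_sub_sq_nonpos (β := (v - u) * (H.coeff k - κ) - (β - γ))
    (γ := H.coeff k - κ) hu hv fun δ h1 h2 => by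
      have := hmax (u + δ) (v - δ) (by linarith) (by linarith) (by ring)
      rw [coeff_mul_linFactor_pair, coeff_mul_linFactor_pair] at this
      linarith
  linarith

/-- The six linear factors of distinguished vertices. -/
noncomputable def sixFactors (a b c d e f : ℝ) : ℝ[X] :=
  linFactor a * linFactor b * linFactor c * linFactor d * linFactor e * linFactor f

/-- Here `s` is the centre of the paw, `a` the weight of both other triangle vertices, `c` the
pendant vertex and `d` a vertex outside the paw. Trading the paw for a star at `s` replaces a² by sd
in the missing weight, and averaging `a` with `d` gains the right-hand side. The last four
hypotheses are the first-order conditions for the pairs a,d; s,d; a,c; s,a. -/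
theorem triangle_pendant_inequality {Q s a c d g k Eac Esa : ℝ} (hQ : 0 < Q) (hs : 0 < s)
    (hc : 0 < c) (hg : 0 ≤ g) (hk : 0 ≤ k)
    (hE : Eac ≤ Esa) (hac : 4 * Q ≤ Eac) (hsa : 4 * Q ≤ Esa) (hsa' : s < a)
    (had : (d - a) * (g + s * k) = Q * (s + a))
    (hsd : (d - s) * (g + a * k) = Q * (2 * a + c))
    (hcc : (c - a) * Eac = Q * a) (hss : (a - s) * (Esa - Q) = Q * c) :
    Q * (s * d - a * a) ≤ (g + s * k) * ((d - a) / 2) ^ 2 := by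
  obtain ⟨p, rfl⟩ : ∃ p, s = a - p := ⟨a - s, by ring⟩
  obtain ⟨q, rfl⟩ : ∃ q, c = a + q := ⟨c - a, by ring⟩
  obtain ⟨u, rfl⟩ : ∃ u, d = a + u := ⟨d - a, by ring⟩
  have ha : 0 < a := hs.trans hsa'
  have hp : 0 < p := by linarith
  simp only [add_sub_cancel_left, sub_sub_cancel] at *
  have hE0 : 0 < Eac := by linarith
  have hE1 : 0 < Esa := by linarith
  have hq : 0 < q := by
    by_contra hq
    have : q * Eac ≤ 0 := mul_nonpos_of_nonpos_of_nonneg (not_lt.1 hq) hE0.le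
    have : 0 < Q * a := mul_pos hQ ha
    linarith
  have hq4 : 4 * q ≤ a := by
    have : q * (4 * Q) ≤ q * Eac := mul_le_mul_of_nonneg_left hac hq.le
    exact le_of_mul_le_mul_left (by linarith : Q * (4 * q) ≤ Q * a) hQ
  have hp3 : 3 * p ≤ a + q := by
    have : p * (4 * Q) ≤ p * Esa := mul_le_mul_of_nonneg_left hsa hp.le
    exact le_of_mul_le_mul_left (by linarith : Q * (3 * p) ≤ Q * (a + q)) hQ
  have hpq : p * a ≤ q * (a + q + p) := by
    have h1 : p * Esa * a = q * Eac * (a + q + p) := by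
      rw [hcc, show p * Esa = Q * (a + q + p) by linarith]; ring
    have h2 : q * (a + q + p) * Eac ≤ q * (a + q + p) * Esa :=
      mul_le_mul_of_nonneg_left hE (by positivity)
    exact le_of_mul_le_mul_right (by linarith : p * a * Esa ≤ q * (a + q + p) * Esa) hE1
  have h3p : 3 * p ^ 2 ≤ 4 * (q * (a - p)) := by
    have h1 : 3 * p * (a + q + p) ≤ 4 * a * (a - p) := by nlinarith
    have h2 : 3 * p * (p * a) ≤ 3 * p * (q * (a + q + p)) :=
      mul_le_mul_of_nonneg_left hpq (by positivity)
    have h3 : q * (3 * p * (a + q + p)) ≤ q * (4 * a * (a - p)) :=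
      mul_le_mul_of_nonneg_left h1 hq.le
    exact le_of_mul_le_mul_left (by linarith : a * (3 * p ^ 2) ≤ a * (4 * (q * (a - p)))) ha
  have hEad : 0 ≤ g + (a - p) * k := by positivity
  have hu : 0 < u := by
    by_contra hu
    have : u * (g + (a - p) * k) ≤ 0 := mul_nonpos_of_nonpos_of_nonneg (not_lt.1 hu) hEad
    have : 0 < Q * (a - p + a) := mul_pos hQ (by linarith)
    linarith
  -- This eliminates `g` and `k` between `had` and `hsd`, using s(g + ak) ≤ a(g + sk) for s ≤ a.
  have hcmp : u * (a - p) * (3 * a + q) ≤ (u + p) * a * (2 * a - p) := by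
    have h1 : (a - p) * (g + a * k) ≤ a * (g + (a - p) * k) := by
      have := mul_nonneg hp.le hg
      linarith
    have h2 := mul_le_mul_of_nonneg_left h1 (by positivity : 0 ≤ u * (u + p))
    have h3 : u * (u + p) * ((a - p) * (g + a * k)) = Q * (u * (a - p) * (3 * a + q)) := by
      linear_combination u * (a - p) * hsd
    have h4 : u * (u + p) * (a * (g + (a - p) * k)) = Q * ((u + p) * a * (2 * a - p)) := by
      linear_combination (u + p) * a * had
    exact le_of_mul_le_mul_left (by linarith) hQ
  -- By `had` the gain is Qu(2a - p)/4, while sd - a² = u(a - p) - pa; comparing the two gives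
  -- exactly this bound.
  have hfin : u * (2 * a - 3 * p) ≤ 4 * p * a := by
    have h1 : u * (3 * p ^ 2) ≤ u * (4 * (q * (a - p))) := mul_le_mul_of_nonneg_left h3p hu.le
    refine le_of_mul_le_mul_right (?_ : u * (2 * a - 3 * p) * (2 * a - p) ≤
      4 * p * a * (2 * a - p)) (by linarith)
    nlinarith
  have : (g + (a - p) * k) * (u / 2) ^ 2 = Q * (u * (2 * a - p) / 4) := by
    linear_combination u / 4 * had
  rw [this]
  refine mul_le_mul_of_nonneg_left ?_ hQ.le
  nlinarith

-- Stationarity and swapping give a = b, q ≤ s < a < c and a < d. The star keeps `q` and `s` in its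
-- core, and one copy of `a` is averaged with `d`.
set_option maxHeartbeats 1000000 in
theorem star_ge_of_triangle_pendant {G : ℝ[X]} (hG : CoeffNonneg G) {n : ℕ} {P : ℝ} (hP : 0 < P)
    (hPG : P ≤ G.coeff n) {q s a b c d : ℝ} (hq : 0 < q) (hs : 0 < s) (ha : 0 < a) (hb : 0 < b)
    (hc : 0 < c) (hd : 0 < d)
    (hmax : ∀ q' s' a' b' c' d', 0 ≤ q' → 0 ≤ s' → 0 ≤ a' → 0 ≤ b' → 0 ≤ c' → 0 ≤ d' →
      q' + s' + a' + b' + c' + d' = q + s + a + b + c + d →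
      (G * sixFactors q' s' a' b' c' d').coeff (n + 3)
          - P * q' * (s' * (a' + b' + c') + a' * b') ≤
        (G * sixFactors q s a b c d).coeff (n + 3) - P * q * (s * (a + b + c) + a * b)) :
    ∃ q' s' a' b' c' d', 0 ≤ q' ∧ 0 ≤ s' ∧ 0 ≤ a' ∧ 0 ≤ b' ∧ 0 ≤ c' ∧ 0 ≤ d' ∧
      q' + s' + a' + b' + c' + d' = q + s + a + b + c + d ∧
      (G * sixFactors q s a b c d).coeff (n + 3) - P * q * (s * (a + b + c) + a * b) ≤
        (G * sixFactors q' s' a' b' c' d').coeff (n + 3)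
          - P * q' * s' * (a' + b' + c' + d') := by
  have hPq : 0 < P * q := mul_pos hP hq
  have hab : a = b := by
    have h := stationary_pair (H := G * linFactor q * linFactor s * linFactor c * linFactor d)
      (k := n + 1) (β := P * q * s) (γ := P * q * s) (κ := P * q) (c := P * q * (s * c)) ha hb
      fun u v hu hv huv => by
        have := hmax q s u v c d hq.le hs.le hu hv hc.le hd.le (by linarith)
        unfold sixFactors at this
        convert this using 1 <;> ring_nf
    have h4 := hG.le_coeff_succ_mul_four hq.le hs.le hc.le hd.le hPG
    have h5 : 0 < (s + c + d) * P := by positivity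
    rw [sub_self, mul_eq_zero] at h
    rcases h with h | h <;> linarith
  subst hab
  -- Exchanging `q` and `s` changes only the missing term P q a².
  have hqs : q ≤ s := by
    have := hmax s q a a c d hs.le hq.le ha.le ha.le hc.le hd.le (by ring)
    rw [show sixFactors s q a a c d = sixFactors q s a a c d by unfold sixFactors; ring] at this
    exact le_of_mul_le_mul_left (by linarith : P * (a * a) * q ≤ P * (a * a) * s) (by positivity)
  have had := stationary_pair (H := G * linFactor q * linFactor s * linFactor a * linFactor c)
      (k := n + 1) (β := P * q * (s + a)) (γ := 0) (κ := 0) (c := P * q * (s * (a + c))) ha hd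
      fun u v hu hv huv => by
        have := hmax q s u a c v hq.le hs.le hu ha.le hc.le hv (by linarith)
        unfold sixFactors at this
        convert this using 1 <;> ring_nf
  have hsd := stationary_pair (H := G * linFactor q * linFactor a * linFactor a * linFactor c)
      (k := n + 1) (β := P * q * (2 * a + c)) (γ := 0) (κ := 0) (c := P * q * (a * a)) hs hd
      fun u v hu hv huv => by
        have := hmax q u a a c v hq.le hu ha.le ha.le hc.le hv (by linarith)
        unfold sixFactors at this
        convert this using 1 <;> ring_nf
  have hac := stationary_pair (H := G * linFactor q * linFactor s * linFactor a * linFactor d)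
      (k := n + 1) (β := P * q * (s + a)) (γ := P * q * s) (κ := 0) (c := P * q * (s * a)) ha hc
      fun u v hu hv huv => by
        have := hmax q s u a v d hq.le hs.le hu ha.le hv hd.le (by linarith)
        unfold sixFactors at this
        convert this using 1 <;> ring_nf
  have hsa := stationary_pair (H := G * linFactor q * linFactor a * linFactor c * linFactor d)
      (k := n + 1) (β := P * q * (a + c)) (γ := P * q * a) (κ := P * q) (c := 0) hs ha
      fun u v hu hv huv => by
        have := hmax q u v a c d hq.le hu hv ha.le hc.le hd.le (by linarith)
        unfold sixFactors at this
        convert this using 1 <;> ring_nf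
  have bsa := hG.le_coeff_succ_mul_four hq.le ha.le hc.le hd.le hPG
  have bac := hG.le_coeff_succ_mul_four hq.le hs.le ha.le hd.le hPG
  have hGq := hG.mul_linFactor hq.le
  have hGqac := (hGq.mul_linFactor ha.le).mul_linFactor hc.le
  have hGqad := (hGq.mul_linFactor ha.le).mul_linFactor hd.le
  have e1 : (G * linFactor q * linFactor s * linFactor a * linFactor c).coeff (n + 1) =
      (G * linFactor q * linFactor a * linFactor c).coeff (n + 1) +
        s * (G * linFactor q * linFactor a * linFactor c).coeff n := by
    rw [← coeff_mul_linFactor]; congr 1; ring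
  have e2 : (G * linFactor q * linFactor a * linFactor a * linFactor c).coeff (n + 1) =
      (G * linFactor q * linFactor a * linFactor c).coeff (n + 1) +
        a * (G * linFactor q * linFactor a * linFactor c).coeff n := by
    rw [← coeff_mul_linFactor]; congr 1; ring
  have e3 : (G * linFactor q * linFactor s * linFactor a * linFactor d).coeff (n + 1) =
      (G * linFactor q * linFactor a * linFactor d).coeff (n + 1) +
        s * (G * linFactor q * linFactor a * linFactor d).coeff n := by
    rw [← coeff_mul_linFactor]; congr 1; ring
  have e4 : (G * linFactor q * linFactor a * linFactor c * linFactor d).coeff (n + 1) =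
      (G * linFactor q * linFactor a * linFactor d).coeff (n + 1) +
        c * (G * linFactor q * linFactor a * linFactor d).coeff n := by
    rw [← coeff_mul_linFactor]; congr 1; ring
  have hsa1 : s < a := by
    by_contra hcon
    have h1 : 0 < (a + c + d) * P := by positivity
    have h2 : (a - s) * ((G * linFactor q * linFactor a * linFactor c * linFactor d).coeff (n + 1)
        - P * q) ≤ 0 := mul_nonpos_of_nonpos_of_nonneg (by linarith) (by linarith)
    have : 0 < P * q * c := by positivity
    linarith
  have hbac : 0 < (G * linFactor q * linFactor s * linFactor a * linFactor d).coeff (n + 1) :=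
    lt_of_lt_of_le (by positivity) bac
  have hca : a < c := by
    by_contra hcon
    have h2 := mul_nonpos_of_nonpos_of_nonneg (by linarith : c - a ≤ 0) hbac.le
    have : 0 < P * q * a := by positivity
    linarith
  have hda : a < d := by
    by_contra hcon
    have h2 := mul_nonpos_of_nonpos_of_nonneg (by linarith : d - a ≤ 0)
      ((((hGq.mul_linFactor hs.le).mul_linFactor ha.le).mul_linFactor hc.le) (n + 1))
    have : 0 < P * q * (s + a) := by positivity
    linarith
  -- All of s, a, c, d are at least `q`, so `bac` and `bsa` yield the bounds by 4Pq.
  have hqP : ∀ x, q ≤ x → P * q ≤ x * P := fun x hx => by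
    rw [mul_comm]; exact mul_le_mul_of_nonneg_right hx hP.le
  have key := triangle_pendant_inequality (Q := P * q) (s := s) (a := a) (c := c) (d := d)
    (g := (G * linFactor q * linFactor a * linFactor c).coeff (n + 1))
    (k := (G * linFactor q * linFactor a * linFactor c).coeff n)
    (Eac := (G * linFactor q * linFactor s * linFactor a * linFactor d).coeff (n + 1))
    (Esa := (G * linFactor q * linFactor a * linFactor c * linFactor d).coeff (n + 1))
    hPq hs hc (hGqac _) (hGqac _)
    (by
      rw [e3, e4]
      have := mul_le_mul_of_nonneg_right (by linarith : s ≤ c) (hGqad n)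
      linarith)
    (by
      have h1 := hqP s hqs
      have h2 := hqP a (by linarith)
      have h3 := hqP d (by linarith)
      linarith)
    (by
      have h1 := hqP c (by linarith)
      have h2 := hqP a (by linarith)
      have h3 := hqP d (by linarith)
      linarith)
    hsa1 (by rw [← e1]; linarith) (by rw [← e2]; linarith) (by linarith) (by linarith)
  refine ⟨q, s, (a + d) / 2, a, c, (a + d) / 2, hq.le, hs.le, by positivity, ha.le, hc.le,
    by positivity, by ring, ?_⟩
  rw [← e1] at key
  have f1 : ∀ x y, G * sixFactors q s x a c y =
      G * linFactor q * linFactor s * linFactor a * linFactor c * linFactor x * linFactor y :=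
    fun x y => by unfold sixFactors; ring
  rw [f1, f1, coeff_mul_linFactor_pair _ a d (n + 1),
    coeff_mul_linFactor_pair _ ((a + d) / 2) ((a + d) / 2) (n + 1)]
  linarith

/-- The new weights are the old ones reflected in their mean w + ε. The missing weight drops by
4Pε²(3w - 2ε), the coefficient by at most 8ε³k, and the first-order condition `hst` controls εk. -/
theorem star_ge_of_equal_quadruple {G : ℝ[X]} (hG : CoeffNonneg G) {n : ℕ} {P w ε : ℝ}
    (hP : 0 < P) (hPG : P ≤ G.coeff n) (hw : 0 < w) (hε : 0 ≤ ε)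
    (hst : ε * (G * linFactor w * linFactor w * linFactor w * linFactor (w + 3 * ε)).coeff (n + 1)
      = P * w ^ 2) :
    (G * sixFactors w w w w (w + 3 * ε) (w + 3 * ε)).coeff (n + 3) - 4 * P * w ^ 3 ≤
      (G * sixFactors (w - ε) (w - ε) (w + 2 * ε) (w + 2 * ε) (w + 2 * ε) (w + 2 * ε)).coeff
        (n + 3) - 4 * P * (w - ε) ^ 2 * (w + 2 * ε) := by
  set E := (G * linFactor w * linFactor w * linFactor w * linFactor (w + 3 * ε)).coeff (n + 1)
    with hE
  have hEge : 4 * w * P ≤ E := by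
    have h := hG.le_coeff_succ_mul_four hw.le hw.le hw.le (by positivity : 0 ≤ w + 3 * ε) hPG
    have : 0 ≤ ε * P := by positivity
    linarith
  have hE0 : 0 < E := lt_of_lt_of_le (by positivity) hEge
  have hεw : 4 * ε ≤ w := by
    have h1 : ε * (4 * w * P) ≤ ε * E := mul_le_mul_of_nonneg_left hEge hε
    exact le_of_mul_le_mul_left (by linarith : w * P * (4 * ε) ≤ w * P * w) (by positivity)
  set k := (G * linFactor (w + ε) ^ 3).coeff n with hk
  -- Offsets from the mean are -ε four times and 2ε twice, with all signs reversed in the new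
  -- weights. Hence only odd powers of ε survive in the difference, and the first power cancels
  -- since the offsets sum to zero.
  have hdiff : G * sixFactors w w w w (w + 3 * ε) (w + 3 * ε) =
      G * sixFactors (w - ε) (w - ε) (w + 2 * ε) (w + 2 * ε) (w + 2 * ε) (w + 2 * ε)
        + C (8 * ε ^ 3) * (G * linFactor (w + ε) ^ 3 * X ^ 3)
        - C (24 * ε ^ 5) * (X ^ 5 * (G * linFactor (w + ε))) := by
    simp only [sixFactors, linFactor, map_add, map_sub, map_mul, map_pow, map_ofNat]
    ring
  have hnn : 0 ≤ (C (24 * ε ^ 5) * (X ^ 5 * (G * linFactor (w + ε)))).coeff (n + 3) := by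
    have h1 : CoeffNonneg (C (24 * ε ^ 5) * X ^ 5 * (G * linFactor (w + ε))) :=
      (coeffNonneg_monomial (by positivity) 5).mul (hG.mul_linFactor (by positivity))
    rw [← mul_assoc]
    exact h1 _
  have hk8 : (C (8 * ε ^ 3) * (G * linFactor (w + ε) ^ 3 * X ^ 3)).coeff (n + 3) =
      8 * ε ^ 3 * k := by
    rw [coeff_C_mul, coeff_mul_X_pow]
  rw [hdiff, coeff_sub, coeff_add, hk8]
  -- With `hst` this gives 2εk ≤ (5/2)Pw, and 4ε ≤ w gives (5/2)w ≤ 3w - 2ε: the constant 4/5 is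
  -- just large enough.
  have hkE : 4 / 5 * w * k ≤ E := by
    have hpoly : G * linFactor w * linFactor w * linFactor w * linFactor (w + 3 * ε) =
        C (4 / 5 * w) * (G * linFactor (w + ε) ^ 3 * X) +
        G * (1 + C (16 / 5 * w + 3 * ε) * X ^ 1
          + C (18 / 5 * w ^ 2 + 33 / 5 * w * ε) * X ^ 2
          + C (8 / 5 * w ^ 3 + 21 / 5 * w ^ 2 * ε - 12 / 5 * w * ε ^ 2) * X ^ 3
          + C (1 / 5 * w ^ 4 + 3 / 5 * w ^ 3 * ε - 12 / 5 * w ^ 2 * ε ^ 2 - 4 / 5 * w * ε ^ 3)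
            * X ^ 4) := by
      have c1 : (16 / 5 * w + 3 * ε) = 4 * w + 3 * ε - (4 / 5 * w) := by ring
      have c2 : 18 / 5 * w ^ 2 + 33 / 5 * w * ε =
        6 * w ^ 2 + 9 * w * ε - (4 / 5 * w) * (3 * (w + ε)) := by ring
      have c3 : 8 / 5 * w ^ 3 + 21 / 5 * w ^ 2 * ε - 12 / 5 * w * ε ^ 2 =
        4 * w ^ 3 + 9 * w ^ 2 * ε - (4 / 5 * w) * (3 * (w + ε) ^ 2) := by ring
      have c4 : 1 / 5 * w ^ 4 + 3 / 5 * w ^ 3 * ε - 12 / 5 * w ^ 2 * ε ^ 2 - 4 / 5 * w * ε ^ 3 =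
        w ^ 4 + 3 * w ^ 3 * ε - (4 / 5 * w) * (w + ε) ^ 3 := by ring
      rw [c1, c2, c3, c4]
      generalize 4 / 5 * w = x
      simp only [linFactor, map_add, map_sub, map_mul, map_pow, map_ofNat]
      ring
    have h2 : 0 ≤ ε * (w - 4 * ε) := mul_nonneg hε (by linarith)
    have hc3 : 0 ≤ 8 / 5 * w ^ 3 + 21 / 5 * w ^ 2 * ε - 12 / 5 * w * ε ^ 2 := by
      have : 0 ≤ w * (ε * (w - 4 * ε)) := by positivity
      have : 0 ≤ w ^ 3 := by positivity
      have : 0 ≤ w ^ 2 * ε := by positivity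
      nlinarith
    have hc4 : 0 ≤ 1 / 5 * w ^ 4 + 3 / 5 * w ^ 3 * ε - 12 / 5 * w ^ 2 * ε ^ 2
        - 4 / 5 * w * ε ^ 3 := by
      have e1 : 0 ≤ w ^ 2 * (ε * (w - 4 * ε)) := by positivity
      have e2 : 0 ≤ w * ε * (ε * (w - 4 * ε)) := by positivity
      have e3 : 0 ≤ w ^ 3 * (w - 4 * ε) := mul_nonneg (by positivity) (by linarith)
      nlinarith
    have hnn := hG.mul ((((coeffNonneg_one.add
      (coeffNonneg_monomial (by positivity : 0 ≤ 16 / 5 * w + 3 * ε) 1)).add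
      (coeffNonneg_monomial (by positivity : 0 ≤ 18 / 5 * w ^ 2 + 33 / 5 * w * ε) 2)).add
      (coeffNonneg_monomial hc3 3)).add (coeffNonneg_monomial hc4 4)) (n + 1)
    rw [hE, hpoly, coeff_add, coeff_C_mul, coeff_mul_X]
    linarith
  have hloss : 2 * ε * k ≤ P * (3 * w - 2 * ε) := by
    refine le_of_mul_le_mul_right (?_ : 2 * ε * k * E ≤ P * (3 * w - 2 * ε) * E) hE0
    have h1 : 2 * ε * k * E = 2 * P * w ^ 2 * k := by linear_combination 2 * k * hst
    have h2 : P * w * (4 / 5 * w * k) ≤ P * w * E := mul_le_mul_of_nonneg_left hkE (by positivity)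
    have h3 : 0 ≤ P * E * (w - 4 * ε) := mul_nonneg (by positivity) (by linarith)
    linarith
  have := mul_le_mul_of_nonneg_left hloss (by positivity : 0 ≤ 4 * ε ^ 2)
  linarith

/-- Stationarity equalises the four weights in the quadruple and the two outside it, which is the
shape treated in `star_ge_of_equal_quadruple`. -/
theorem star_ge_of_quadruple {G : ℝ[X]} (hG : CoeffNonneg G) {n : ℕ} {P : ℝ} (hP : 0 < P)
    (hPG : P ≤ G.coeff n) {a b c d y z : ℝ} (ha : 0 < a) (hb : 0 < b) (hc : 0 < c) (hd : 0 < d)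
    (hy : 0 < y) (hz : 0 < z)
    (hmax : ∀ a' b' c' d' y' z', 0 ≤ a' → 0 ≤ b' → 0 ≤ c' → 0 ≤ d' → 0 ≤ y' → 0 ≤ z' →
      a' + b' + c' + d' + y' + z' = a + b + c + d + y + z →
      (G * sixFactors a' b' c' d' y' z').coeff (n + 3)
          - P * (a' * b' * c' + a' * b' * d' + a' * c' * d' + b' * c' * d') ≤
        (G * sixFactors a b c d y z).coeff (n + 3)
          - P * (a * b * c + a * b * d + a * c * d + b * c * d)) :
    ∃ a' b' c' d' y' z', 0 ≤ a' ∧ 0 ≤ b' ∧ 0 ≤ c' ∧ 0 ≤ d' ∧ 0 ≤ y' ∧ 0 ≤ z' ∧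
      a' + b' + c' + d' + y' + z' = a + b + c + d + y + z ∧
      (G * sixFactors a b c d y z).coeff (n + 3)
          - P * (a * b * c + a * b * d + a * c * d + b * c * d) ≤
        (G * sixFactors a' b' c' d' y' z').coeff (n + 3)
          - P * a' * b' * (c' + d' + y' + z') := by
  have hab : a = b := by
    have h := stationary_pair (H := G * linFactor c * linFactor d * linFactor y * linFactor z)
      (k := n + 1) (β := P * (c * d)) (γ := P * (c * d)) (κ := P * (c + d)) (c := 0) ha hb
      fun u v hu hv huv => by
        have := hmax u v c d y z hu hv hc.le hd.le hy.le hz.le (by linarith)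
        unfold sixFactors at this
        convert this using 1 <;> ring_nf
    have h4 := hG.le_coeff_succ_mul_four hc.le hd.le hy.le hz.le hPG
    have h5 : 0 < (y + z) * P := by positivity
    rw [sub_self, mul_eq_zero] at h
    rcases h with h | h <;> linarith
  have hac : a = c := by
    have h := stationary_pair (H := G * linFactor b * linFactor d * linFactor y * linFactor z)
      (k := n + 1) (β := P * (b * d)) (γ := P * (b * d)) (κ := P * (b + d)) (c := 0) ha hc
      fun u v hu hv huv => by
        have := hmax u b v d y z hu hb.le hv hd.le hy.le hz.le (by linarith)
        unfold sixFactors at this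
        convert this using 1 <;> ring_nf
    have h4 := hG.le_coeff_succ_mul_four hb.le hd.le hy.le hz.le hPG
    have h5 : 0 < (y + z) * P := by positivity
    rw [sub_self, mul_eq_zero] at h
    rcases h with h | h <;> linarith
  have had : a = d := by
    have h := stationary_pair (H := G * linFactor b * linFactor c * linFactor y * linFactor z)
      (k := n + 1) (β := P * (b * c)) (γ := P * (b * c)) (κ := P * (b + c)) (c := 0) ha hd
      fun u v hu hv huv => by
        have := hmax u b c v y z hu hb.le hc.le hv hy.le hz.le (by linarith)
        unfold sixFactors at this
        convert this using 1 <;> ring_nf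
    have h4 := hG.le_coeff_succ_mul_four hb.le hc.le hy.le hz.le hPG
    have h5 : 0 < (y + z) * P := by positivity
    rw [sub_self, mul_eq_zero] at h
    rcases h with h | h <;> linarith
  have hyz : y = z := by
    have h := stationary_pair (H := G * linFactor a * linFactor b * linFactor c * linFactor d)
      (k := n + 1) (β := 0) (γ := 0) (κ := 0)
      (c := P * (a * b * c + a * b * d + a * c * d + b * c * d)) hy hz
      fun u v hu hv huv => by
        have := hmax a b c d u v ha.le hb.le hc.le hd.le hu hv (by linarith)
        unfold sixFactors at this
        convert this using 1 <;> ring_nf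
    have h4 := hG.le_coeff_succ_mul_four ha.le hb.le hc.le hd.le hPG
    have h5 : 0 < (a + b + c + d) * P := by positivity
    rw [sub_self, mul_eq_zero] at h
    rcases h with h | h <;> linarith
  subst hab hac had hyz
  have hay := stationary_pair (H := G * linFactor a * linFactor a * linFactor a * linFactor y)
      (k := n + 1) (β := P * (3 * a ^ 2)) (γ := 0) (κ := 0) (c := P * a ^ 3) ha hy
      fun u v hu hv huv => by
        have := hmax u a a a v y hu ha.le ha.le ha.le hv hy.le (by linarith)
        unfold sixFactors at this
        convert this using 1 <;> ring_nf
  have h4 := hG.le_coeff_succ_mul_four ha.le ha.le ha.le hy.le hPG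
  have h5 : 0 < (a + a + a + y) * P := by positivity
  obtain ⟨ε, rfl⟩ : ∃ ε, y = a + 3 * ε := ⟨(y - a) / 3, by ring⟩
  have hε : 0 ≤ ε := by
    by_contra hcon
    have h6 := mul_nonpos_of_nonpos_of_nonneg (by linarith : (a + 3 * ε) - a ≤ 0)
      (h5.le.trans h4)
    have : 0 < P * (3 * a ^ 2) := by positivity
    linarith
  have key := star_ge_of_equal_quadruple hG hP hPG ha hε (by linarith)
  have hεa : ε ≤ a := by
    refine le_of_mul_le_mul_right (?_ : ε * ((a + a + a + (a + 3 * ε)) * P) ≤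
      a * ((a + a + a + (a + 3 * ε)) * P)) h5
    have := mul_le_mul_of_nonneg_left h4 hε
    have : 0 ≤ P * a ^ 2 := by positivity
    have : 0 ≤ P * a * ε := by positivity
    linarith
  refine ⟨a - ε, a - ε, a + 2 * ε, a + 2 * ε, a + 2 * ε, a + 2 * ε, by linarith, by linarith,
    by linarith, by linarith, by linarith, by linarith, by ring, ?_⟩
  linarith

end Generating

/-! ### Reduction to interior maxima over six weights. -/

section SixWeights
open Polynomial

theorem continuous_coeff_mul_linFactor {E : Type*} [TopologicalSpace E] {p : E → ℝ[X]} {f : E → ℝ}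
    (hp : ∀ k, Continuous fun v => (p v).coeff k) (hf : Continuous f) (k : ℕ) :
    Continuous fun v => (p v * linFactor (f v)).coeff k := by
  rcases k with _ | k
  · simpa [linFactor, mul_add] using hp 0
  · simp only [coeff_mul_linFactor]
    exact (hp _).add (hf.mul (hp _))

theorem exists_isMaxOn_nonneg_sum_eq {ι : Type*} [Fintype ι] {g : (ι → ℝ) → ℝ}
    (hg : Continuous g) {v : ι → ℝ} (hv : ∀ i, 0 ≤ v i) :
    ∃ u : ι → ℝ, (∀ i, 0 ≤ u i) ∧ ∑ i, u i = ∑ i, v i ∧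
      ∀ u' : ι → ℝ, (∀ i, 0 ≤ u' i) → ∑ i, u' i = ∑ i, v i → g u' ≤ g u := by
  let S : Set (ι → ℝ) := {u | (∀ i, 0 ≤ u i) ∧ ∑ i, u i = ∑ i, v i}
  have hclosed : IsClosed S := by
    refine IsClosed.inter (s₁ := {u : ι → ℝ | ∀ i, 0 ≤ u i})
      (s₂ := {u : ι → ℝ | ∑ i, u i = ∑ i, v i}) ?_ ?_
    · rw [show {u : ι → ℝ | ∀ i, 0 ≤ u i} = ⋂ i, {u | 0 ≤ u i} by ext; simp]
      exact isClosed_iInter fun i => isClosed_le continuous_const (continuous_apply i)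
    · exact isClosed_eq (continuous_finsetSum _ fun i _ => continuous_apply i) continuous_const
  have hsub : S ⊆ Set.univ.pi fun _ => Set.Icc 0 (∑ i, v i) := fun u hu i _ =>
    ⟨hu.1 i, hu.2 ▸ single_le_sum (fun j _ => hu.1 j) (mem_univ i)⟩
  have hcomp : IsCompact S :=
    (isCompact_univ_pi fun _ => isCompact_Icc).of_isClosed_subset hclosed hsub
  obtain ⟨u, hu, hmax⟩ := hcomp.exists_isMaxOn ⟨v, hv, rfl⟩ hg.continuousOn
  exact ⟨u, hu.1, hu.2, fun u' h1 h2 => hmax ⟨h1, h2⟩⟩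

/-- The elementary symmetric function of degree `r` in all weights, as a function of the six
distinguished ones. -/
noncomputable def sixCoeff (G : ℝ[X]) (r : ℕ) (v : Fin 6 → ℝ) : ℝ :=
  (G * sixFactors (v 0) (v 1) (v 2) (v 3) (v 4) (v 5)).coeff r

theorem continuous_sixCoeff (G : ℝ[X]) (r : ℕ) : Continuous (sixCoeff G r) := by
  have e : sixCoeff G r = fun v => (G * linFactor (v 0) * linFactor (v 1) * linFactor (v 2) *
      linFactor (v 3) * linFactor (v 4) * linFactor (v 5)).coeff r := by
    funext v
    simp only [sixCoeff, sixFactors, mul_assoc]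
  rw [e]
  iterate 6
    refine continuous_coeff_mul_linFactor (fun k => ?_) (continuous_apply _) _
  exact continuous_const

theorem sixCoeff_comp_perm (G : ℝ[X]) (r : ℕ) (v : Fin 6 → ℝ) (σ : Equiv.Perm (Fin 6)) :
    sixCoeff G r (v ∘ σ) = sixCoeff G r v := by
  have : ∀ u : Fin 6 → ℝ, sixFactors (u 0) (u 1) (u 2) (u 3) (u 4) (u 5) =
      ∏ i, linFactor (u i) := fun u => by rw [Fin.prod_univ_six]; rfl
  unfold sixCoeff
  rw [this (v ∘ σ), this v]
  have h := Equiv.prod_comp σ fun i => linFactor (v i)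
  simp only [Function.comp_apply]
  rw [h]

/-- The weight of the missing edges if these are a star on the six distinguished vertices. -/
def starWeight (P : ℝ) (v : Fin 6 → ℝ) : ℝ := P * v 0 * v 1 * (v 2 + v 3 + v 4 + v 5)

/-- Pass to a maximiser with the same total. If one of its weights is zero, a permutation puts that
weight into the core of the star, which then weighs nothing, while the coefficient is symmetric. If
`P = 0`, the star weighs nothing anyway. -/
theorem exists_star_ge {G : ℝ[X]} {r : ℕ} {P : ℝ} (hP : 0 ≤ P) {N : (Fin 6 → ℝ) → ℝ}
    (hNc : Continuous N) (hN : ∀ v, (∀ i, 0 ≤ v i) → 0 ≤ N v)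
    (h : 0 < P → ∀ v : Fin 6 → ℝ, (∀ i, 0 < v i) →
      (∀ v' : Fin 6 → ℝ, (∀ i, 0 ≤ v' i) → ∑ i, v' i = ∑ i, v i →
        sixCoeff G r v' - N v' ≤ sixCoeff G r v - N v) →
      ∃ v' : Fin 6 → ℝ, (∀ i, 0 ≤ v' i) ∧ ∑ i, v' i = ∑ i, v i ∧
        sixCoeff G r v - N v ≤ sixCoeff G r v' - starWeight P v')
    {v : Fin 6 → ℝ} (hv : ∀ i, 0 ≤ v i) :
    ∃ v' : Fin 6 → ℝ, (∀ i, 0 ≤ v' i) ∧ ∑ i, v' i = ∑ i, v i ∧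
      sixCoeff G r v - N v ≤ sixCoeff G r v' - starWeight P v' := by
  obtain ⟨u, hu0, hus, humax⟩ :=
    exists_isMaxOn_nonneg_sum_eq ((continuous_sixCoeff G r).sub hNc) hv
  suffices hsuff : ∃ v' : Fin 6 → ℝ, (∀ i, 0 ≤ v' i) ∧ ∑ i, v' i = ∑ i, u i ∧
      sixCoeff G r u - N u ≤ sixCoeff G r v' - starWeight P v' by
    obtain ⟨v', h0, h1, h2⟩ := hsuff
    exact ⟨v', h0, h1.trans hus, (humax v hv rfl).trans h2⟩
  by_cases hpos : 0 < P ∧ ∀ i, 0 < u i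
  · exact h hpos.1 u hpos.2 fun v' h0 h1 => humax v' h0 (h1.trans hus)
  · have hNu := hN u hu0
    by_cases hP0 : 0 < P
    · obtain ⟨i, hi⟩ : ∃ i, u i ≤ 0 := by
        by_contra hcon
        push Not at hcon
        exact hpos ⟨hP0, hcon⟩
      have hi0 : u i = 0 := le_antisymm hi (hu0 i)
      refine ⟨u ∘ Equiv.swap 0 i, fun j => hu0 _, Equiv.sum_comp _ u, ?_⟩
      rw [sixCoeff_comp_perm]
      simp only [starWeight, Function.comp, Equiv.swap_apply_left, hi0]
      linarith
    · have : P = 0 := le_antisymm (not_lt.1 hP0) hP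
      refine ⟨u, hu0, rfl, ?_⟩
      simp only [starWeight, this]
      linarith

theorem exists_star_ge_triangle_pendant {G : ℝ[X]} (hG : CoeffNonneg G) {n : ℕ} {P : ℝ}
    (hP : 0 ≤ P) (hPG : P ≤ G.coeff n) {v : Fin 6 → ℝ} (hv : ∀ i, 0 ≤ v i) :
    ∃ v' : Fin 6 → ℝ, (∀ i, 0 ≤ v' i) ∧ ∑ i, v' i = ∑ i, v i ∧
      sixCoeff G (n + 3) v - P * v 0 * (v 1 * (v 2 + v 3 + v 4) + v 2 * v 3) ≤
        sixCoeff G (n + 3) v' - starWeight P v' := by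
  refine exists_star_ge (N := fun v => P * v 0 * (v 1 * (v 2 + v 3 + v 4) + v 2 * v 3)) hP
    (by fun_prop) (fun v hv => ?_) (fun hP u hu humax => ?_) hv
  · have := hv 0; have := hv 1; have := hv 2; have := hv 3; have := hv 4
    positivity
  · obtain ⟨q, s, a, b, c, d, hq, hs, ha, hb, hc, hd, hsum, hle⟩ :=
      star_ge_of_triangle_pendant hG hP hPG (hu 0) (hu 1) (hu 2) (hu 3) (hu 4) (hu 5)
        fun q s a b c d hq hs ha hb hc hd hsum => by
          have := humax ![q, s, a, b, c, d] (by simp [Fin.forall_fin_succ, *])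
            (by simpa [Fin.sum_univ_six] using hsum)
          simpa [sixCoeff] using this
    refine ⟨![q, s, a, b, c, d], by simp [Fin.forall_fin_succ, *],
      by simpa [Fin.sum_univ_six] using hsum, ?_⟩
    simpa [sixCoeff, starWeight] using hle

theorem exists_star_ge_quadruple {G : ℝ[X]} (hG : CoeffNonneg G) {n : ℕ} {P : ℝ}
    (hP : 0 ≤ P) (hPG : P ≤ G.coeff n) {v : Fin 6 → ℝ} (hv : ∀ i, 0 ≤ v i) :
    ∃ v' : Fin 6 → ℝ, (∀ i, 0 ≤ v' i) ∧ ∑ i, v' i = ∑ i, v i ∧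
      sixCoeff G (n + 3) v -
          P * (v 0 * v 1 * v 2 + v 0 * v 1 * v 3 + v 0 * v 2 * v 3 + v 1 * v 2 * v 3) ≤
        sixCoeff G (n + 3) v' - starWeight P v' := by
  refine exists_star_ge (N := fun v =>
      P * (v 0 * v 1 * v 2 + v 0 * v 1 * v 3 + v 0 * v 2 * v 3 + v 1 * v 2 * v 3)) hP
    (by fun_prop) (fun v hv => ?_) (fun hP u hu humax => ?_) hv
  · have := hv 0; have := hv 1; have := hv 2; have := hv 3
    positivity
  · obtain ⟨q, s, a, b, c, d, hq, hs, ha, hb, hc, hd, hsum, hle⟩ :=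
      star_ge_of_quadruple hG hP hPG (hu 0) (hu 1) (hu 2) (hu 3) (hu 4) (hu 5)
        fun q s a b c d hq hs ha hb hc hd hsum => by
          have := humax ![q, s, a, b, c, d] (by simp [Fin.forall_fin_succ, *])
            (by simpa [Fin.sum_univ_six] using hsum)
          simpa [sixCoeff] using this
    refine ⟨![q, s, a, b, c, d], by simp [Fin.forall_fin_succ, *],
      by simpa [Fin.sum_univ_six] using hsum, ?_⟩
    simpa [sixCoeff, starWeight] using hle

end SixWeights

/-! ### From six weights to weights on all vertices. -/

section Symmetric
open Polynomial

/-- The elementary symmetric function of degree `r` in the weights `y i`, `i ∈ s`. -/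
def elemSymm (s : Finset ℕ) (r : ℕ) (y : ℕ → ℝ) : ℝ := ∑ A ∈ s.powersetCard r, ∏ i ∈ A, y i

theorem coeff_prod_linFactor (s : Finset ℕ) (r : ℕ) (y : ℕ → ℝ) :
    (∏ i ∈ s, linFactor (y i)).coeff r = elemSymm s r y := by
  simp only [linFactor, elemSymm]
  rw [prod_one_add, finsetSum_coeff, powersetCard_eq_filter, sum_filter]
  refine sum_congr rfl fun A _ => ?_
  rw [prod_mul_distrib, prod_const, ← map_prod, coeff_C_mul_X_pow]
  simp only [eq_comm]

theorem coeffNonneg_prod_linFactor {s : Finset ℕ} {y : ℕ → ℝ} (hy : ∀ i ∈ s, 0 ≤ y i) :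
    CoeffNonneg (∏ i ∈ s, linFactor (y i)) := fun k => by
  rw [coeff_prod_linFactor]
  exact sum_nonneg fun A hA => prod_nonneg fun i hi => hy i ((mem_powersetCard.1 hA).1 hi)

/-- Weights on `ℕ` with the six weights at `n, …, n + 5` replaced. -/
def replaceSix (n : ℕ) (v : Fin 6 → ℝ) (y : ℕ → ℝ) (i : ℕ) : ℝ :=
  if h : n ≤ i ∧ i - n < 6 then v ⟨i - n, h.2⟩ else y i

theorem replaceSix_add (n : ℕ) (v : Fin 6 → ℝ) (y : ℕ → ℝ) (j : Fin 6) :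
    replaceSix n v y (n + j) = v j := by
  rw [replaceSix, dif_pos ⟨by omega, by omega⟩]
  congr 1
  ext
  simp

theorem replaceSix_of_notMem {n : ℕ} (v : Fin 6 → ℝ) (y : ℕ → ℝ) {i : ℕ}
    (hi : i ∉ Ico n (n + 6)) : replaceSix n v y i = y i := by
  rw [replaceSix, dif_neg]
  rw [mem_Ico] at hi
  omega

theorem prod_Ico_six {M : Type*} [CommMonoid M] (f : ℕ → M) (n : ℕ) :
    ∏ i ∈ Ico n (n + 6), f i =
      f n * f (n + 1) * f (n + 2) * f (n + 3) * f (n + 4) * f (n + 5) := by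
  rw [prod_Ico_eq_prod_range, Nat.add_sub_cancel_left]
  simp [prod_range_succ]

theorem elemSymm_range_eq_sixCoeff {n t : ℕ} (ht : n + 6 ≤ t) (r : ℕ) (y : ℕ → ℝ) :
    elemSymm (range t) r y =
      sixCoeff (∏ i ∈ range t \ Ico n (n + 6), linFactor (y i)) r fun j => y (n + j) := by
  rw [← coeff_prod_linFactor, sixCoeff, sixFactors, ← prod_sdiff (s₁ := Ico n (n + 6)),
    prod_Ico_six]
  · rfl
  · intro i hi
    rw [mem_Ico] at hi
    exact mem_range.2 (by omega)

theorem exists_weights_of_six {n t : ℕ} (ht : n + 6 ≤ t) {y : ℕ → ℝ} (hy : ∀ i < t, 0 ≤ y i)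
    {v : Fin 6 → ℝ} (hv : ∀ i, 0 ≤ v i) (hsum : ∑ i, v i = ∑ i : Fin 6, y (n + i)) :
    ∃ y' : ℕ → ℝ, (∀ i < t, 0 ≤ y' i) ∧ ∑ i ∈ range t, y' i = ∑ i ∈ range t, y i ∧
      (∀ r, elemSymm (range t) r y' =
        sixCoeff (∏ i ∈ range t \ Ico n (n + 6), linFactor (y i)) r v) ∧
      (∏ i ∈ range n, y' i = ∏ i ∈ range n, y i) ∧ ∀ j : Fin 6, y' (n + j) = v j := by
  refine ⟨replaceSix n v y, fun i hi => ?_, ?_, fun r => ?_, ?_, replaceSix_add n v y⟩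
  · rw [replaceSix]
    split_ifs
    exacts [hv _, hy i hi]
  · have hsub : Ico n (n + 6) ⊆ range t := fun i hi => by
      rw [mem_Ico] at hi
      exact mem_range.2 (by omega)
    rw [← sum_sdiff hsub, ← sum_sdiff hsub]
    congr 1
    · exact sum_congr rfl fun i hi => replaceSix_of_notMem v y (mem_sdiff.1 hi).2
    · rw [sum_Ico_eq_sum_range, sum_Ico_eq_sum_range, Nat.add_sub_cancel_left,
        ← Fin.sum_univ_eq_sum_range (fun i => replaceSix n v y (n + i)),
        ← Fin.sum_univ_eq_sum_range (fun i => y (n + i)), ← hsum]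
      exact sum_congr rfl fun j _ => replaceSix_add n v y j
  · rw [elemSymm_range_eq_sixCoeff ht]
    congr 1
    · exact prod_congr rfl fun i hi => by rw [replaceSix_of_notMem v y (mem_sdiff.1 hi).2]
    · exact funext fun j => replaceSix_add n v y j
  · refine prod_congr rfl fun i hi => replaceSix_of_notMem v y fun h => ?_
    rw [mem_Ico] at h
    rw [mem_range] at hi
    omega

theorem prod_range_le_coeff_sdiff {n t : ℕ} (ht : n + 6 ≤ t) {y : ℕ → ℝ}
    (hy : ∀ i < t, 0 ≤ y i) :
    ∏ i ∈ range n, y i ≤ (∏ i ∈ range t \ Ico n (n + 6), linFactor (y i)).coeff n := by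
  rw [coeff_prod_linFactor]
  refine single_le_sum (f := fun A => ∏ i ∈ A, y i) (fun A hA => prod_nonneg fun i hi => hy i ?_) ?_
  · exact mem_range.1 (mem_sdiff.1 ((mem_powersetCard.1 hA).1 hi)).1
  · refine mem_powersetCard.2 ⟨fun i hi => ?_, card_range n⟩
    simp only [mem_sdiff, mem_range, mem_Ico] at *
    omega

/-- The total weight of `{0, …, k - 1} ∪ {k + i}`, `i < 4`. -/
def starMissing (k : ℕ) (y : ℕ → ℝ) : ℝ :=
  (∏ i ∈ range k, y i) * (y k + y (k + 1) + y (k + 2) + y (k + 3))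

/-- The total weight of the sets `{0, …, k - 1} ∪ e`, with `e` running over the edges of the
triangle `k, k + 1, k + 2` with the pendant edge `k, k + 3`. -/
def pawMissing (k : ℕ) (y : ℕ → ℝ) : ℝ :=
  (∏ i ∈ range k, y i) * (y k * (y (k + 1) + y (k + 2) + y (k + 3)) + y (k + 1) * y (k + 2))

/-- The total weight of `{0, …, k + 3} \ {k + i}`, `i < 4`. -/
def quadMissing (k : ℕ) (y : ℕ → ℝ) : ℝ :=
  (∏ i ∈ range k, y i) * (y k * y (k + 1) * y (k + 2) + y k * y (k + 1) * y (k + 3)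
    + y k * y (k + 2) * y (k + 3) + y (k + 1) * y (k + 2) * y (k + 3))

theorem exists_starMissing_ge_of_six {n t : ℕ} (ht : n + 6 ≤ t) {y : ℕ → ℝ}
    (hy : ∀ i < t, 0 ≤ y i) {c : ℝ}
    (h : ∃ v' : Fin 6 → ℝ, (∀ i, 0 ≤ v' i) ∧ ∑ i, v' i = ∑ i : Fin 6, y (n + i) ∧
      c ≤ sixCoeff (∏ i ∈ range t \ Ico n (n + 6), linFactor (y i)) (n + 3) v'
        - starWeight (∏ i ∈ range n, y i) v') :
    ∃ y' : ℕ → ℝ, (∀ i < t, 0 ≤ y' i) ∧ ∑ i ∈ range t, y' i = ∑ i ∈ range t, y i ∧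
      c ≤ elemSymm (range t) (n + 3) y' - starMissing (n + 2) y' := by
  obtain ⟨v, hv, hsum, hle⟩ := h
  obtain ⟨y', h0, h1, h2, h3, h4⟩ := exists_weights_of_six ht hy hv hsum
  refine ⟨y', h0, h1, hle.trans_eq ?_⟩
  rw [h2, starMissing, starWeight, prod_range_succ, prod_range_succ, h3]
  have e0 := h4 0
  have e1 := h4 1
  have e2 := h4 2
  have e3 := h4 3
  have e4 := h4 4
  have e5 := h4 5
  simp only [Fin.coe_ofNat_eq_mod, Nat.reduceMod, add_zero] at e0 e1 e2 e3 e4 e5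
  rw [e0, e1, ← e2, ← e3, ← e4, ← e5]

theorem exists_starMissing_ge_pawMissing {n t : ℕ} (ht : n + 6 ≤ t) {y : ℕ → ℝ}
    (hy : ∀ i < t, 0 ≤ y i) :
    ∃ y' : ℕ → ℝ, (∀ i < t, 0 ≤ y' i) ∧ ∑ i ∈ range t, y' i = ∑ i ∈ range t, y i ∧
      elemSymm (range t) (n + 3) y - pawMissing (n + 1) y ≤
        elemSymm (range t) (n + 3) y' - starMissing (n + 2) y' := by
  refine exists_starMissing_ge_of_six ht hy ?_
  rw [elemSymm_range_eq_sixCoeff ht, pawMissing, prod_range_succ]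
  exact exists_star_ge_triangle_pendant
    (coeffNonneg_prod_linFactor fun i hi => hy i (mem_range.1 (mem_sdiff.1 hi).1))
    (prod_nonneg fun i hi => hy i (by rw [mem_range] at hi; omega))
    (prod_range_le_coeff_sdiff ht hy) (v := fun j => y (n + j)) fun j => hy _ (by omega)

theorem exists_starMissing_ge_quadMissing {n t : ℕ} (ht : n + 6 ≤ t) {y : ℕ → ℝ}
    (hy : ∀ i < t, 0 ≤ y i) :
    ∃ y' : ℕ → ℝ, (∀ i < t, 0 ≤ y' i) ∧ ∑ i ∈ range t, y' i = ∑ i ∈ range t, y i ∧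
      elemSymm (range t) (n + 3) y - quadMissing n y ≤
        elemSymm (range t) (n + 3) y' - starMissing (n + 2) y' := by
  refine exists_starMissing_ge_of_six ht hy ?_
  rw [elemSymm_range_eq_sixCoeff ht, quadMissing]
  exact exists_star_ge_quadruple
    (coeffNonneg_prod_linFactor fun i hi => hy i (mem_range.1 (mem_sdiff.1 hi).1))
    (prod_nonneg fun i hi => hy i (by rw [mem_range] at hi; omega))
    (prod_range_le_coeff_sdiff ht hy) (v := fun j => y (n + j)) fun j => hy _ (by omega)

/-- For r = 2 the pair 0, 1 is itself missing, so moving the weight of 0 onto 1 costs e_2 only y₀y₁,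
already counted in the paw. The star centred at 0 then has weight zero. -/
theorem exists_starMissing_ge_pawMissing_two {t : ℕ} (ht : 4 ≤ t) {y : ℕ → ℝ}
    (hy : ∀ i < t, 0 ≤ y i) :
    ∃ y' : ℕ → ℝ, (∀ i < t, 0 ≤ y' i) ∧ ∑ i ∈ range t, y' i = ∑ i ∈ range t, y i ∧
      elemSymm (range t) 2 y - pawMissing 0 y ≤ elemSymm (range t) 2 y' - starMissing 1 y' := by
  obtain ⟨s, rfl⟩ : ∃ s, t = s + 2 := ⟨t - 2, by omega⟩
  let y' : ℕ → ℝ := fun i => if i = 0 then 0 else if i = 1 then y 0 + y 1 else y i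
  have h0 : y' 0 = 0 := rfl
  have h1 : y' 1 = y 0 + y 1 := rfl
  have h2 : ∀ i, y' (i + 2) = y (i + 2) := fun i => by simp [y']
  have hrange : ∀ f : ℕ → ℝ, ∑ i ∈ range (s + 2), f i = f 0 + f 1 + ∑ i ∈ range s, f (i + 2) :=
    fun f => by rw [sum_range_succ', sum_range_succ']; ring
  have hsymm : ∀ f : ℕ → ℝ, elemSymm (range (s + 2)) 2 f =
      (∏ i ∈ range s, linFactor (f (i + 2))).coeff 2
        + (f 0 + f 1) * (∏ i ∈ range s, linFactor (f (i + 2))).coeff 1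
        + f 0 * f 1 * (∏ i ∈ range s, linFactor (f (i + 2))).coeff 0 := fun f => by
    rw [← coeff_prod_linFactor, prod_range_succ', prod_range_succ', zero_add,
      coeff_mul_linFactor_pair _ _ _ 0]
    ring
  have hone : ∀ f : ℕ → ℝ, (∏ i ∈ range s, linFactor (f (i + 2))).coeff 0 = 1 := fun f => by
    rw [coeff_zero_eq_eval_zero, eval_prod]
    exact prod_eq_one fun i _ => by simp [linFactor]
  refine ⟨y', fun i hi => ?_, ?_, ?_⟩
  · have := hy 0 (by omega)
    have := hy 1 (by omega)
    rcases i with _ | _ | i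
    exacts [h0.ge, by rw [zero_add, h1]; positivity, (h2 i).symm ▸ hy _ hi]
  · rw [hrange, hrange, h0, h1]
    simp only [h2]
    ring
  · rw [hsymm, hsymm, hone, hone, h0, h1]
    simp only [h2, starMissing, pawMissing, prod_range_one, prod_range_zero, h0]
    have := mul_nonneg (hy 0 (by omega)) (hy 2 (by omega))
    have := mul_nonneg (hy 0 (by omega)) (hy 3 (by omega))
    have := mul_nonneg (hy 1 (by omega)) (hy 2 (by omega))
    norm_num
    linarith

end Symmetric

/-! ### Lower bounds for the weight of four missing sets. -/

section Compression

/-- Nonnegative weights that increase on `range t`. -/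
def SortedWeights (t : ℕ) (y : ℕ → ℝ) : Prop :=
  (∀ i < t, 0 ≤ y i) ∧ ∀ i j, i ≤ j → j < t → y i ≤ y j

variable {t : ℕ} {y : ℕ → ℝ}

theorem exists_mem_ge_of_card {A : Finset ℕ} {n : ℕ} (hn : n < A.card) : ∃ j ∈ A, n ≤ j := by
  by_contra hcon
  push Not at hcon
  have := card_le_card (fun j hj => mem_range.2 (hcon j hj) : A ⊆ range n)
  rw [card_range] at this
  omega

theorem SortedWeights.prod_range_le (hy : SortedWeights t y) {n : ℕ} :
    ∀ {A : Finset ℕ}, A ⊆ range t → A.card = n → ∏ i ∈ range n, y i ≤ ∏ i ∈ A, y i := by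
  induction n with
  | zero =>
    intro A _ hA
    simp [card_eq_zero.1 hA]
  | succ n ih =>
    intro A hAt hA
    obtain ⟨j, hj, hnj⟩ := exists_mem_ge_of_card (A := A) (n := n) (by omega)
    have hjt := mem_range.1 (hAt hj)
    rw [prod_range_succ, ← prod_erase_mul _ _ hj]
    have herase := (erase_subset j A).trans hAt
    exact mul_le_mul (ih herase (by rw [card_erase_of_mem hj, hA]; rfl)) (hy.2 _ _ hnj hjt)
      (hy.1 _ (by omega)) (prod_nonneg fun i hi => hy.1 i (mem_range.1 (herase hi)))

theorem SortedWeights.prod_range_mul_le (hy : SortedWeights t y) {A S : Finset ℕ}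
    (hAt : A ⊆ range t) (hS : S ⊆ A) {n : ℕ} (hA : A.card = n + S.card) {c : ℝ}
    (hcS : c ≤ ∏ i ∈ S, y i) : (∏ i ∈ range n, y i) * c ≤ ∏ i ∈ A, y i := by
  have hsd := (sdiff_subset (s := A) (t := S)).trans hAt
  have hcard : (A \ S).card = n := by rw [card_sdiff_of_subset hS]; omega
  rw [← prod_sdiff hS]
  have hle := hy.prod_range_le hsd hcard
  have hn : 0 ≤ ∏ i ∈ range n, y i := prod_nonneg fun i hi => hy.1 i <| by
    have h1 := card_le_card hsd
    rw [card_range] at h1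
    rw [mem_range] at hi
    omega
  exact (mul_le_mul_of_nonneg_left hcS hn).trans (mul_le_mul_of_nonneg_right hle
    (prod_nonneg fun i hi => hy.1 i (mem_range.1 (hAt (hS hi)))))

theorem SortedWeights.prod_range_mul_le_of_mem (hy : SortedWeights t y) {A : Finset ℕ}
    (hAt : A ⊆ range t) {n : ℕ} (hA : A.card = n + 1) {l j : ℕ} (hlj : l ≤ j) (hj : j ∈ A) :
    (∏ i ∈ range n, y i) * y l ≤ ∏ i ∈ A, y i :=
  hy.prod_range_mul_le hAt (singleton_subset_iff.2 hj) (by simpa using hA)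
    (by simpa using hy.2 _ _ hlj (mem_range.1 (hAt hj)))

/-- A set that omits an element of {0, …, n} has two elements beyond `n`. -/
theorem SortedWeights.prod_range_mul_mul_le (hy : SortedWeights t y) {A : Finset ℕ}
    (hAt : A ⊆ range t) {n : ℕ} (hA : A.card = n + 2) (hn : ¬ range (n + 1) ⊆ A) :
    (∏ i ∈ range n, y i) * (y (n + 1) * y (n + 2)) ≤ ∏ i ∈ A, y i := by
  have hcard : 1 < (A \ range (n + 1)).card := by
    have h1 := card_sdiff_add_card_inter A (range (n + 1))
    have h2 : (A ∩ range (n + 1)).card < (range (n + 1)).card :=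
      card_lt_card ⟨inter_subset_right, fun h => hn (h.trans inter_subset_left)⟩
    rw [card_range] at h2
    omega
  obtain ⟨i, hi, j, hj, hij⟩ := one_lt_card.1 hcard
  rw [mem_sdiff, mem_range] at hi hj
  wlog hlt : i < j generalizing i j
  · exact this j hj i hi hij.symm (by omega)
  refine hy.prod_range_mul_le hAt (S := {i, j}) ?_ ?_ ?_
  · intro x hx
    rw [mem_insert, mem_singleton] at hx
    rcases hx with rfl | rfl
    exacts [hi.1, hj.1]
  · rw [card_pair hij, hA]
  · rw [prod_pair hij]
    have hit := mem_range.1 (hAt hi.1)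
    have hjt := mem_range.1 (hAt hj.1)
    exact mul_le_mul (hy.2 _ _ (by omega) hit) (hy.2 _ _ (by omega) hjt) (hy.1 _ (by omega))
      (hy.1 _ hit)

theorem eq_insert_range {A : Finset ℕ} {k : ℕ} (hA : A.card = k + 1) (h : range k ⊆ A) :
    ∃ j, k ≤ j ∧ A = insert j (range k) := by
  obtain ⟨j, hj⟩ := card_eq_one.1 (by rw [card_sdiff_of_subset h, hA, card_range]; omega :
    (A \ range k).card = 1)
  have hjm : j ∈ A \ range k := hj ▸ mem_singleton_self j
  refine ⟨j, by simpa using (mem_sdiff.1 hjm).2, ?_⟩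
  rw [insert_eq, ← hj, sdiff_union_of_subset h]

theorem eq_erase_range {A : Finset ℕ} {n : ℕ} (hA : A.card = n) (h : A ⊆ range (n + 1)) :
    ∃ j < n + 1, A = (range (n + 1)).erase j := by
  obtain ⟨j, hj⟩ := card_eq_one.1 (by rw [card_sdiff_of_subset h, hA, card_range]; omega :
    (range (n + 1) \ A).card = 1)
  have hjm : j ∈ range (n + 1) \ A := hj ▸ mem_singleton_self j
  refine ⟨j, mem_range.1 (mem_sdiff.1 hjm).1, ?_⟩
  rw [erase_eq, ← hj, Finset.sdiff_sdiff_eq_self h]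

/-- At most one of two distinct sets is the lightest one; the other has an element beyond `k`. -/
theorem SortedWeights.add_le_of_ne (hy : SortedWeights t y) {k : ℕ} {A B : Finset ℕ}
    (hAt : A ⊆ range t) (hBt : B ⊆ range t) (hA : A.card = k + 1) (hB : B.card = k + 1)
    (hAB : A ≠ B) :
    (∏ i ∈ range k, y i) * (y k + y (k + 1)) ≤ ∏ i ∈ A, y i + ∏ i ∈ B, y i := by
  wlog hne : A ≠ range (k + 1) generalizing A B
  · rw [not_not] at hne
    rw [add_comm (∏ i ∈ A, y i)]
    exact this hBt hAt hB hA hAB.symm fun h => hAB (hne.trans h.symm)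
  obtain ⟨j, hj, hkj⟩ : ∃ j ∈ A, k + 1 ≤ j := by
    by_contra hcon
    push Not at hcon
    exact hne (eq_of_subset_of_card_le (fun j hj => mem_range.2 (hcon j hj))
      (by rw [card_range, hA]))
  have h1 := hy.prod_range_mul_le_of_mem hAt hA hkj hj
  have h2 := hy.prod_range_le hBt hB
  rw [prod_range_succ] at h2
  linarith

/-- Among any four `r`-sets, two are distinct from the two lightest ones. -/
theorem exists_pair_of_card_four {F : Finset (Finset ℕ)} (hF : F.card = 4) (L L' : Finset ℕ) :
    ∃ A ∈ F, ∃ B ∈ F, ∃ C ∈ F, ∃ D ∈ F, A ≠ B ∧ C ≠ D ∧ (C ≠ L ∧ C ≠ L') ∧ (D ≠ L ∧ D ≠ L') ∧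
      ∀ f : Finset ℕ → ℝ, ∑ S ∈ F, f S = f A + f B + (f C + f D) := by
  have h1 : 1 < (F \ {L, L'}).card := by
    have := le_card_sdiff {L, L'} F
    have := card_le_two (a := L) (b := L')
    omega
  obtain ⟨C, hC, D, hD, hCD⟩ := one_lt_card.1 h1
  simp only [mem_sdiff, mem_insert, mem_singleton, not_or] at hC hD
  have hD' : D ∈ F.erase C := mem_erase.2 ⟨hCD.symm, hD.1⟩
  have h2 : ((F.erase C).erase D).card = 2 := by
    rw [card_erase_of_mem hD', card_erase_of_mem hC.1, hF]
  obtain ⟨A, B, hAB, hE⟩ := card_eq_two.1 h2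
  have hA : A ∈ (F.erase C).erase D := hE ▸ mem_insert_self _ _
  have hB : B ∈ (F.erase C).erase D := hE ▸ mem_insert_of_mem (mem_singleton_self _)
  refine ⟨A, mem_of_mem_erase (mem_of_mem_erase hA), B, mem_of_mem_erase (mem_of_mem_erase hB),
    C, hC.1, D, hD.1, hAB, hCD, hC.2, hD.2, fun f => ?_⟩
  rw [← add_sum_erase _ _ hC.1, ← add_sum_erase _ _ hD', hE, sum_pair hAB]
  ring

/-- Four sets of the same size weigh at least as much as a star, a triangle with a pendant edge, or
four subsets of a set that is larger by one. -/
theorem SortedWeights.missing_le (hy : SortedWeights t y) {r : ℕ} (hr : 1 ≤ r)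
    {F : Finset (Finset ℕ)} (hFt : F ⊆ (range t).powersetCard r) (hF : F.card = 4) :
    (∃ k, r = k + 1 ∧ k + 4 ≤ t ∧ starMissing k y ≤ ∑ A ∈ F, ∏ i ∈ A, y i) ∨
    (∃ k, r = k + 2 ∧ k + 4 ≤ t ∧ pawMissing k y ≤ ∑ A ∈ F, ∏ i ∈ A, y i) ∨
    (∃ k, r = k + 3 ∧ k + 4 ≤ t ∧ quadMissing k y ≤ ∑ A ∈ F, ∏ i ∈ A, y i) := by
  obtain ⟨k, rfl⟩ : ∃ k, r = k + 1 := ⟨r - 1, by omega⟩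
  obtain ⟨A, hAF, B, hBF, C, hCF, D, hDF, hAB, hCD, hCL, hDL, hsum⟩ :=
    exists_pair_of_card_four hF (insert k (range k)) (insert (k + 1) (range k))
  rw [hsum fun S => ∏ i ∈ S, y i]
  obtain ⟨hAt, hA⟩ := mem_powersetCard.1 (hFt hAF)
  obtain ⟨hBt, hB⟩ := mem_powersetCard.1 (hFt hBF)
  obtain ⟨hCt, hC⟩ := mem_powersetCard.1 (hFt hCF)
  obtain ⟨hDt, hD⟩ := mem_powersetCard.1 (hFt hDF)
  have hlow := hy.add_le_of_ne hAt hBt hA hB hAB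
  clear hsum hFt hF hAB hAt hBt hA hB hAF hBF hCF hDF
  have hrow : ∀ S : Finset ℕ, S ⊆ range t → S.card = k + 1 →
      (S ≠ insert k (range k) ∧ S ≠ insert (k + 1) (range k)) → range k ⊆ S →
      ∃ j, k + 2 ≤ j ∧ j < t ∧ S = insert j (range k) := fun S hSt hS hSL hk => by
    obtain ⟨j, hj, rfl⟩ := eq_insert_range hS hk
    refine ⟨j, ?_, mem_range.1 (hSt (mem_insert_self _ _)), rfl⟩
    by_contra hcon
    rcases (by omega : j = k ∨ j = k + 1) with rfl | rfl
    exacts [hSL.1 rfl, hSL.2 rfl]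
  -- Omitting `k` or `k + 1` from {0, …, k+1} gives the two excluded sets.
  have hcol : ∀ S : Finset ℕ, S.card = k + 1 →
      (S ≠ insert k (range k) ∧ S ≠ insert (k + 1) (range k)) → S ⊆ range (k + 2) →
      ∃ j < k, S = (range (k + 2)).erase j := fun S hS hSL hk => by
    obtain ⟨j, hj, rfl⟩ := eq_erase_range hS hk
    refine ⟨j, ?_, rfl⟩
    by_contra hcon
    rcases (by omega : j = k ∨ j = k + 1) with rfl | rfl
    · refine hSL.2 ?_
      ext i
      simp only [mem_erase, mem_range, mem_insert]
      omega
    · refine hSL.1 ?_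
      ext i
      simp only [mem_erase, mem_range, mem_insert]
      omega
  -- `S` weighs at least as much as {0, …, k-2, k, k+1}, and `S'` at least as much as {0, …, k-1,
  -- k+2}. Together with the two lightest sets these form a paw.
  have hmid : ∀ S S' : Finset ℕ, S ⊆ range t → S' ⊆ range t → S.card = k + 1 → S'.card = k + 1 →
      ¬ range k ⊆ S → ¬ S' ⊆ range (k + 2) →
      (∃ l, k + 1 = l + 2 ∧ l + 4 ≤ t ∧ (∏ i ∈ range k, y i) * (y k + y (k + 1)) +
        (∏ i ∈ S, y i + ∏ i ∈ S', y i) ≥ pawMissing l y) := by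
    intro S S' hSt hSt' hS hS' h h'
    obtain ⟨l, rfl⟩ : ∃ l, k = l + 1 := by
      refine ⟨k - 1, ?_⟩
      rcases k with _ | k
      · exact absurd (by simp) h
      · rfl
    obtain ⟨j, hj, hkj⟩ := not_subset.1 h'
    rw [mem_range, not_lt] at hkj
    have h1 := hy.prod_range_mul_mul_le hSt hS h
    have h2 := hy.prod_range_mul_le_of_mem hSt' hS' hkj hj
    have := mem_range.1 (hSt' hj)
    refine ⟨l, rfl, by omega, ?_⟩
    rw [prod_range_succ] at h2 ⊢
    unfold pawMissing
    linarith
  by_cases hC1 : range k ⊆ C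
  · by_cases hD1 : range k ⊆ D
    · left
      obtain ⟨i, hi, hit, rfl⟩ := hrow C hCt hC hCL hC1
      obtain ⟨j, hj, hjt, rfl⟩ := hrow D hDt hD hDL hD1
      have hij : i ≠ j := fun h => hCD (by rw [h])
      have hp : ∀ l, k ≤ l → ∏ i ∈ insert l (range k), y i = (∏ i ∈ range k, y i) * y l :=
        fun l hl => by rw [prod_insert (by simpa using hl), mul_comm]
      have hW : 0 ≤ ∏ i ∈ range k, y i := prod_nonneg fun l hl => hy.1 l <| by
        rw [mem_range] at hl
        omega
      refine ⟨k, rfl, by omega, ?_⟩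
      rw [hp i (by omega), hp j (by omega)]
      have hyy : y (k + 2) + y (k + 3) ≤ y i + y j := by
        rcases lt_or_gt_of_ne hij with h | h
        · exact add_le_add (hy.2 _ _ hi hit) (hy.2 _ _ (by omega) hjt)
        · rw [add_comm (y i)]
          exact add_le_add (hy.2 _ _ hj hjt) (hy.2 _ _ (by omega) hit)
      have := mul_le_mul_of_nonneg_left hyy hW
      unfold starMissing
      linarith
    · right; left
      have hC2 : ¬ C ⊆ range (k + 2) := fun h => by
        obtain ⟨i, hi, hit, rfl⟩ := hrow C hCt hC hCL hC1
        have := mem_range.1 (h (mem_insert_self _ _))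
        omega
      obtain ⟨l, h1, h2, h3⟩ := hmid D C hDt hCt hD hC hD1 hC2
      exact ⟨l, h1, h2, by linarith⟩
  · right
    by_cases hD2 : D ⊆ range (k + 2)
    · by_cases hC2 : C ⊆ range (k + 2)
      · right
        obtain ⟨i, hi, rfl⟩ := hcol C hC hCL hC2
        obtain ⟨j, hj, rfl⟩ := hcol D hD hDL hD2
        wlog hij : i < j generalizing i j
        · have hji : j ≠ i := fun h => hCD (by rw [h])
          rw [add_comm (∏ l ∈ (range (k + 2)).erase i, y l)]
          refine this j hj hDL hDt hD ?_ hD2 i hi hCL hCt hC hC2 hCD.symm (by omega)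
          intro h
          have := h (mem_range.2 hj)
          simp at this
        -- Since i < j < k, the first set contains the top three elements of {0, …, k+1} and the
        -- second contains the top two; the remaining elements are bounded by initial segments.
        obtain ⟨l, rfl⟩ : ∃ l, k = l + 2 := ⟨k - 2, by omega⟩
        have h1 := hy.prod_range_mul_le hCt (S := {l + 1, l + 2, l + 3}) (n := l)
          (c := y (l + 1) * y (l + 2) * y (l + 3)) (fun x hx => by
            simp only [mem_insert, mem_singleton] at hx
            simp only [mem_erase, mem_range]
            omega) (by rw [hC]; simp) (by simp [mul_assoc])
        have h2 := hy.prod_range_mul_le hDt (S := {l + 2, l + 3}) (n := l + 1)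
          (c := y (l + 2) * y (l + 3)) (fun x hx => by
            simp only [mem_insert, mem_singleton] at hx
            simp only [mem_erase, mem_range]
            omega) (by rw [hD]; simp) (by simp)
        have ht : l + 3 ∈ (range (l + 2 + 2)).erase i := by
          simp only [mem_erase, mem_range]
          omega
        have := mem_range.1 (hCt ht)
        refine ⟨l, rfl, by omega, ?_⟩
        rw [prod_range_succ] at h2 hlow
        rw [prod_range_succ] at hlow
        unfold quadMissing
        linarith
      · left
        have hD1 : ¬ range k ⊆ D := fun h => by
          obtain ⟨i, hi, hit, rfl⟩ := hrow D hDt hD hDL h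
          have := mem_range.1 (hD2 (mem_insert_self _ _))
          omega
        obtain ⟨l, h1, h2, h3⟩ := hmid D C hDt hCt hD hC hD1 hC2
        exact ⟨l, h1, h2, by linarith⟩
    · left
      obtain ⟨l, h1, h2, h3⟩ := hmid C D hCt hDt hC hD hC1 hD2
      exact ⟨l, h1, h2, by linarith⟩

end Compression

/-! ### The last four sets in colex and lower bounds for the Lagrangian of the colex graph. -/

section ColexBound

variable {r m t : ℕ}

/-- The order reversal between `{0, …, t - 1}` and `{1, …, t}`, on sets. -/
def reflect (t : ℕ) (A : Finset ℕ) : Finset ℕ := A.image fun i => t - i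

theorem mem_reflect {A : Finset ℕ} (hA : A ⊆ range t) {a : ℕ} :
    a ∈ reflect t A ↔ 1 ≤ a ∧ a ≤ t ∧ t - a ∈ A := by
  rw [reflect, mem_image]
  constructor
  · rintro ⟨i, hi, rfl⟩
    have := mem_range.1 (hA hi)
    exact ⟨by omega, by omega, by rwa [Nat.sub_sub_self this.le]⟩
  · rintro ⟨h1, h2, h3⟩
    exact ⟨t - a, h3, Nat.sub_sub_self h2⟩

theorem injOn_sub_range : Set.InjOn (fun i => t - i) (range t : Set ℕ) := by
  intro i hi j hj h
  simp only [coe_range, Set.mem_Iio] at hi hj h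
  omega

theorem reflect_mem_powersetCard {A : Finset ℕ} (hA : A ∈ (range t).powersetCard r) :
    reflect t A ∈ (Icc 1 t).powersetCard r := by
  rw [mem_powersetCard] at hA ⊢
  refine ⟨fun a ha => ?_, ?_⟩
  · have := (mem_reflect hA.1).1 ha
    exact mem_Icc.2 ⟨this.1, this.2.1⟩
  · rw [reflect, card_image_of_injOn (injOn_sub_range.mono (coe_subset.2 hA.1)), hA.2]

theorem injOn_reflect : Set.InjOn (reflect t) ((range t).powersetCard r : Set (Finset ℕ)) := by
  intro A hA B hB h
  have hA' := (mem_powersetCard.1 (mem_coe.1 hA)).1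
  have hB' := (mem_powersetCard.1 (mem_coe.1 hB)).1
  have key : ∀ S T : Finset ℕ, S ⊆ range t → T ⊆ range t → reflect t S = reflect t T → S ⊆ T := by
    intro S T hS hT h i hi
    have hit := mem_range.1 (hS hi)
    have : t - i ∈ reflect t T := h ▸ mem_image_of_mem _ hi
    have := ((mem_reflect hT).1 this).2.2
    rwa [Nat.sub_sub_self hit.le] at this
  exact (key A B hA' hB' h).antisymm (key B A hB' hA' h.symm)

/-- Reversing the order turns colex, decided by the largest difference, into a comparison decided by
the smallest. -/
theorem reflect_lt {A L : Finset ℕ} (hA : A ∈ (range t).powersetCard r)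
    (hL : L ∈ (range t).powersetCard r) (hne : A ≠ L)
    (h : ∀ a ∈ A, a ∉ L → ∃ b ∈ L, b ∉ A ∧ b ≤ a) :
    toColex (reflect t A) < toColex (reflect t L) := by
  have hA' := (mem_powersetCard.1 hA).1
  have hL' := (mem_powersetCard.1 hL).1
  rw [Colex.toColex_lt_toColex]
  refine ⟨fun heq => hne (injOn_reflect hA hL heq), fun a ha haL => ?_⟩
  rw [mem_reflect hA'] at ha
  rw [mem_reflect hL'] at haL
  obtain ⟨b, hbL, hbA, hba⟩ := h (t - a) ha.2.2 fun h => haL ⟨ha.1, ha.2.1, h⟩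
  have hbt := mem_range.1 (hL' hbL)
  refine ⟨t - b, mem_image_of_mem _ hbL, fun hb => hbA ?_, by omega⟩
  have := ((mem_reflect hA').1 hb).2.2
  rwa [Nat.sub_sub_self hbt.le] at this

/-- Sets outside `fam` are edges of the colex graph if they precede all of the four sets in
`fam`. -/
theorem reflect_mem_colexGraph (hmt : m + 4 = t.choose r) (h : m ≤ t.choose r)
    {fam : Finset (Finset ℕ)} (hfam : fam ⊆ (range t).powersetCard r) (hcard : fam.card = 4)
    {A : Finset ℕ} (hA : A ∈ (range t).powersetCard r)
    (hlt : ∀ L ∈ fam, toColex (reflect t A) < toColex (reflect t L)) :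
    reflect t A ∈ (colexGraph r m t h).edges := by
  have hAP := reflect_mem_powersetCard hA
  have hAfam : A ∉ fam := fun hmem => lt_irrefl _ (hlt A hmem)
  simp only [colexGraph, Set.Finite.mem_toFinset]
  refine ⟨powersetCard_subset_posSubsets hAP, ?_⟩
  -- `A` and the four sets of `fam` do not precede `A`, which leaves at most `t.choose r - 5 < m`
  -- predecessors.
  set T := (insert A fam).image (reflect t) with hT
  have hTsub : T ⊆ (Icc 1 t).powersetCard r := by
    intro B hB
    obtain ⟨S, hS, rfl⟩ := mem_image.1 hB
    rcases mem_insert.1 hS with rfl | hS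
    exacts [hAP, reflect_mem_powersetCard (hfam hS)]
  have hTcard : T.card = 5 := by
    rw [hT, card_image_of_injOn, card_insert_of_notMem hAfam, hcard]
    exact injOn_reflect.mono (coe_subset.2 (insert_subset hA hfam))
  have hsub : {B | B ∈ posSubsets r ∧ toColex B < toColex (reflect t A)} ⊆
      (((Icc 1 t).powersetCard r \ T : Finset (Finset ℕ)) : Set (Finset ℕ)) := by
    rintro B ⟨hB, hBA⟩
    refine mem_coe.2 (mem_sdiff.2 ⟨posSubsets_pred hAP hB hBA, fun hBT => ?_⟩)
    obtain ⟨S, hS, rfl⟩ := mem_image.1 hBT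
    rcases mem_insert.1 hS with rfl | hS
    exacts [lt_irrefl _ hBA, lt_asymm hBA (hlt S hS)]
  refine (Set.encard_le_encard hsub).trans_lt ?_
  rw [Set.encard_coe_eq_coe_finsetCard, card_sdiff_of_subset hTsub, hTcard, card_powersetCard,
    Nat.card_Icc, Nat.add_sub_cancel, Nat.cast_lt]
  have := card_le_card hTsub
  rw [hTcard, card_powersetCard, Nat.card_Icc, Nat.add_sub_cancel] at this
  omega

/-- By `hprec` the reflected `fam` consists of the last four sets, so every other set is an edge.
The weights need not be sorted, so the bound also applies after they have been changed. -/
theorem elemSymm_sub_le_lagrangian (hmt : m + 4 = t.choose r) (h : m ≤ t.choose r)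
    {fam : Finset (Finset ℕ)} (hfam : fam ⊆ (range t).powersetCard r) (hcard : fam.card = 4)
    (hprec : ∀ A ∈ (range t).powersetCard r, A ∉ fam → ∀ L ∈ fam,
      ∀ a ∈ A, a ∉ L → ∃ b ∈ L, b ∉ A ∧ b ≤ a)
    {y : ℕ → ℝ} (hy : ∀ i < t, 0 ≤ y i) (hsum : ∑ i ∈ range t, y i = 1) :
    elemSymm (range t) r y - ∑ A ∈ fam, ∏ i ∈ A, y i ≤ (colexGraph r m t h).lagrangian := by
  have ht : 0 < t := by
    by_contra hcon
    obtain rfl : t = 0 := by omega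
    simp at hsum
  have hle : (colexGraph r m t h).lagrangePoly (fun v => y (t - v)) ≤
      (colexGraph r m t h).lagrangian := by
    refine (RGraph.isGreatest_lagrangian _ ?_).2 ⟨_, ⟨fun v hv => ?_, ?_⟩, rfl⟩
    · exact ⟨1, mem_Icc.2 ⟨le_rfl, ht⟩⟩
    · have := mem_Icc.1 hv
      exact hy _ (by omega)
    · rw [← hsum]
      refine sum_nbij' (fun v => t - v) (fun i => t - i) ?_ ?_ ?_ ?_ fun _ _ => rfl
      all_goals
        intro i hi
        simp only [colexGraph, mem_Icc, mem_range] at *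
        omega
  refine le_trans ?_ hle
  have hprod : ∀ A ∈ (range t).powersetCard r, ∏ v ∈ reflect t A, y (t - v) = ∏ i ∈ A, y i := by
    intro A hA
    have hA' := (mem_powersetCard.1 hA).1
    rw [reflect, prod_image (injOn_sub_range.mono (coe_subset.2 hA'))]
    exact prod_congr rfl fun i hi => by rw [Nat.sub_sub_self (mem_range.1 (hA' hi)).le]
  have hsdiff := sdiff_subset (s := (range t).powersetCard r) (t := fam)
  calc elemSymm (range t) r y - ∑ A ∈ fam, ∏ i ∈ A, y i
      = ∑ A ∈ (range t).powersetCard r \ fam, ∏ i ∈ A, y i := by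
        rw [elemSymm, ← sum_sdiff hfam, add_sub_cancel_right]
    _ = ∑ A ∈ (range t).powersetCard r \ fam, ∏ v ∈ reflect t A, y (t - v) :=
        sum_congr rfl fun A hA => (hprod A (hsdiff hA)).symm
    _ = ∑ B ∈ ((range t).powersetCard r \ fam).image (reflect t), ∏ v ∈ B, y (t - v) :=
        (sum_image (f := fun B => ∏ v ∈ B, y (t - v))
          (injOn_reflect.mono (coe_subset.2 hsdiff))).symm
    _ ≤ ∑ B ∈ (colexGraph r m t h).edges, ∏ v ∈ B, y (t - v) := by
        refine sum_le_sum_of_subset_of_nonneg (fun B hB => ?_) fun B hB _ =>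
          prod_nonneg fun v hv => ?_
        · obtain ⟨A, hA, rfl⟩ := mem_image.1 hB
          have hA' := mem_sdiff.1 hA
          refine reflect_mem_colexGraph hmt h hfam hcard hA'.1 fun L hL => ?_
          exact reflect_lt hA'.1 (hfam hL) (fun heq => hA'.2 (heq ▸ hL))
            (hprec A hA'.1 hA'.2 L hL)
        · have := (mem_powersetCard.1 ((colexGraph r m t h).edges_subset hB)).1 hv
          have := mem_Icc.1 (show v ∈ Icc 1 t from this)
          exact hy _ (by omega)

/-- With t ≥ k + 4, the initial segment {0, …, k-1} has at least four one-point extensions, and the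
first four of them become the last sets in colex. -/
theorem elemSymm_sub_starMissing_le {k : ℕ} (hmt : m + 4 = t.choose (k + 1))
    (h : m ≤ t.choose (k + 1)) (ht : k + 4 ≤ t) {y : ℕ → ℝ} (hy : ∀ i < t, 0 ≤ y i)
    (hsum : ∑ i ∈ range t, y i = 1) :
    elemSymm (range t) (k + 1) y - starMissing k y ≤ (colexGraph (k + 1) m t h).lagrangian := by
  have hinj : Set.InjOn (fun i => insert (k + i) (range k)) (range 4 : Set ℕ) := by
    intro i _ j _ hij
    dsimp only at hij
    have : k + i ∈ insert (k + j) (range k) := hij ▸ mem_insert_self _ _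
    simp only [mem_insert, mem_range] at this
    omega
  have key := elemSymm_sub_le_lagrangian hmt h
    (fam := (range 4).image fun i => insert (k + i) (range k)) (fun A hA => ?_)
    (by rw [card_image_of_injOn hinj, card_range]) (fun A hA hAf L hL a ha haL => ?_) hy hsum
  · rw [sum_image hinj] at key
    have hp : ∀ l, ∏ i ∈ insert (k + l) (range k), y i = (∏ i ∈ range k, y i) * y (k + l) :=
      fun l => by rw [prod_insert (by simp), mul_comm]
    simp only [hp] at key
    rw [← mul_sum] at key
    simpa [sum_range_succ, starMissing] using key
  · obtain ⟨i, hi, rfl⟩ := mem_image.1 hA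
    rw [mem_range] at hi
    rw [mem_powersetCard]
    refine ⟨fun j hj => ?_, by rw [card_insert_of_notMem (by simp), card_range]⟩
    simp only [mem_insert, mem_range] at *
    omega
  · obtain ⟨i, hi, rfl⟩ := mem_image.1 hL
    rw [mem_range] at hi
    simp only [mem_insert, mem_range, not_or] at haL
    by_cases hk : range k ⊆ A
    · obtain ⟨j, hj, rfl⟩ := eq_insert_range (mem_powersetCard.1 hA).2 hk
      have hj4 : k + 4 ≤ j := by
        by_contra hcon
        refine hAf (mem_image.2 ⟨j - k, mem_range.2 (by omega), ?_⟩)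
        rw [Nat.add_sub_cancel' hj]
      simp only [mem_insert, mem_range] at ha
      refine ⟨k + i, mem_insert_self _ _, ?_, by omega⟩
      simp only [mem_insert, mem_range]
      omega
    · obtain ⟨b, hb, hbA⟩ := not_subset.1 hk
      rw [mem_range] at hb
      exact ⟨b, mem_insert_of_mem (mem_range.2 hb), hbA, by omega⟩

theorem elemSymm_sub_quadMissing_le {k : ℕ} (hmt : m + 4 = (k + 4).choose (k + 3))
    (h : m ≤ (k + 4).choose (k + 3)) {y : ℕ → ℝ} (hy : ∀ i < k + 4, 0 ≤ y i)
    (hsum : ∑ i ∈ range (k + 4), y i = 1) :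
    elemSymm (range (k + 4)) (k + 3) y - quadMissing k y ≤
      (colexGraph (k + 3) m (k + 4) h).lagrangian := by
  have hinj : Set.InjOn (fun i => (range (k + 4)).erase (k + i)) (range 4 : Set ℕ) := by
    intro i hi j hj hij
    simp only [coe_range, Set.mem_Iio] at hi hj
    by_contra hne
    dsimp only at hij
    have : k + i ∈ (range (k + 4)).erase (k + j) := mem_erase.2 ⟨by omega, mem_range.2 (by omega)⟩
    rw [← hij] at this
    simp at this
  have hmem : ∀ i ∈ range 4, k + i ∈ range (k + 4) := fun i hi => by
    rw [mem_range] at *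
    omega
  have key := elemSymm_sub_le_lagrangian hmt h
    (fam := (range 4).image fun i => (range (k + 4)).erase (k + i)) (fun A hA => ?_)
    (by rw [card_image_of_injOn hinj, card_range]) (fun A hA hAf L hL a ha haL => ?_) hy hsum
  · rw [sum_image hinj] at key
    refine le_of_eq_of_le ?_ key
    congr 1
    have e0 : (range (k + 4)).erase (k + 0) = {k + 1, k + 2, k + 3} ∪ range k := by
      ext; simp only [mem_erase, mem_range, mem_union, mem_insert, mem_singleton]; omega
    have e1 : (range (k + 4)).erase (k + 1) = {k, k + 2, k + 3} ∪ range k := by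
      ext; simp only [mem_erase, mem_range, mem_union, mem_insert, mem_singleton]; omega
    have e2 : (range (k + 4)).erase (k + 2) = {k, k + 1, k + 3} ∪ range k := by
      ext; simp only [mem_erase, mem_range, mem_union, mem_insert, mem_singleton]; omega
    have e3 : (range (k + 4)).erase (k + 3) = {k, k + 1, k + 2} ∪ range k := by
      ext; simp only [mem_erase, mem_range, mem_union, mem_insert, mem_singleton]; omega
    simp only [sum_range_succ, sum_range_zero, e0, e1, e2, e3]
    rw [prod_union (by simp), prod_union (by simp), prod_union (by simp), prod_union (by simp)]
    simp [quadMissing]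
    ring
  · obtain ⟨i, hi, rfl⟩ := mem_image.1 hA
    rw [mem_powersetCard, card_erase_of_mem (hmem i hi), card_range]
    exact ⟨erase_subset _ _, rfl⟩
  · obtain ⟨i, hi, rfl⟩ := mem_image.1 hL
    obtain ⟨j, hj, rfl⟩ := eq_erase_range (mem_powersetCard.1 hA).2 (mem_powersetCard.1 hA).1
    have hjk : j < k := by
      by_contra hcon
      refine hAf (mem_image.2 ⟨j - k, mem_range.2 (by omega), ?_⟩)
      rw [Nat.add_sub_cancel' (by omega)]
    simp only [mem_erase, mem_range] at *
    exact ⟨j, ⟨by omega, by omega⟩, by simp, by omega⟩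

/-- With t = k + 4, the segment {0, …, k} has only three one-point extensions, so the fourth set is
{0, …, k-1, k+1, k+2}. -/
theorem elemSymm_sub_pawMissing_le {k : ℕ} (hmt : m + 4 = (k + 4).choose (k + 2))
    (h : m ≤ (k + 4).choose (k + 2)) {y : ℕ → ℝ} (hy : ∀ i < k + 4, 0 ≤ y i)
    (hsum : ∑ i ∈ range (k + 4), y i = 1) :
    elemSymm (range (k + 4)) (k + 2) y - pawMissing k y ≤
      (colexGraph (k + 2) m (k + 4) h).lagrangian := by
  have hinj : Set.InjOn (fun i => insert (k + 1 + i) (range (k + 1))) (range 3 : Set ℕ) := by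
    intro i _ j _ hij
    dsimp only at hij
    have : k + 1 + i ∈ insert (k + 1 + j) (range (k + 1)) := hij ▸ mem_insert_self _ _
    simp only [mem_insert, mem_range] at this
    omega
  have hnot : insert (k + 1) (insert (k + 2) (range k)) ∉
      (range 3).image fun i => insert (k + 1 + i) (range (k + 1)) := fun hmem => by
    obtain ⟨i, _, hi⟩ := mem_image.1 hmem
    have : k ∈ insert (k + 1) (insert (k + 2) (range k)) :=
      hi ▸ mem_insert_of_mem (mem_range.2 (by omega))
    simp at this
  have hcardL : (insert (k + 1) (insert (k + 2) (range k))).card = k + 2 := by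
    rw [card_insert_of_notMem (by simp), card_insert_of_notMem (by simp), card_range]
  have key := elemSymm_sub_le_lagrangian hmt h
    (fam := insert (insert (k + 1) (insert (k + 2) (range k)))
      ((range 3).image fun i => insert (k + 1 + i) (range (k + 1)))) (fun A hA => ?_)
    (by rw [card_insert_of_notMem hnot, card_image_of_injOn hinj, card_range])
    (fun A hA hAf L hL a ha haL => ?_) hy hsum
  · rw [sum_insert hnot, sum_image hinj] at key
    have hp : ∀ l, ∏ i ∈ insert (k + 1 + l) (range (k + 1)), y i =
        (∏ i ∈ range k, y i) * y k * y (k + 1 + l) :=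
      fun l => by rw [prod_insert (by rw [mem_range]; omega), mul_comm, prod_range_succ]
    simp only [hp, sum_range_succ, sum_range_zero, add_zero, zero_add] at key
    rw [prod_insert (by simp), prod_insert (by simp)] at key
    unfold pawMissing
    simp only [add_assoc, Nat.reduceAdd] at key ⊢
    linarith
  · rw [mem_powersetCard]
    rcases mem_insert.1 hA with rfl | hA
    · refine ⟨fun j hj => ?_, hcardL⟩
      simp only [mem_insert, mem_range] at *
      omega
    · obtain ⟨i, hi, rfl⟩ := mem_image.1 hA
      rw [mem_range] at hi
      refine ⟨fun j hj => ?_, by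
        rw [card_insert_of_notMem (by rw [mem_range]; omega), card_range]⟩
      simp only [mem_insert, mem_range] at *
      omega
  · obtain ⟨hAt, hAc⟩ := mem_powersetCard.1 hA
    have hat := mem_range.1 (hAt ha)
    have hk : ¬ range (k + 1) ⊆ A := fun hk => by
      obtain ⟨j, hj, rfl⟩ := eq_insert_range hAc hk
      have hjt := mem_range.1 (hAt (mem_insert_self _ _))
      refine hAf (mem_insert_of_mem (mem_image.2 ⟨j - (k + 1), mem_range.2 (by omega), ?_⟩))
      rw [Nat.add_sub_cancel' hj]
    obtain ⟨b, hb, hbA⟩ := not_subset.1 hk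
    rw [mem_range] at hb
    rcases mem_insert.1 hL with rfl | hL
    · have hne : ¬ insert (k + 1) (insert (k + 2) (range k)) ⊆ A := fun hsub =>
        hAf (mem_insert.2 (Or.inl (eq_of_subset_of_card_le hsub (by rw [hcardL, hAc])).symm))
      simp only [mem_insert, mem_range, not_or] at haL
      -- If a = k, the element `b` of {0, …, k} missing from `A` lies below `k` and hence in `L`. If
      -- a = k + 3, the largest vertex, any element of `L` missing from `A` will do.
      rcases (by omega : a = k ∨ a = k + 3) with rfl | rfl
      · have hba : b ≠ a := fun h => hbA (h ▸ ha)
        refine ⟨b, ?_, hbA, by omega⟩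
        simp only [mem_insert, mem_range]
        omega
      · obtain ⟨c, hc, hcA⟩ := not_subset.1 hne
        refine ⟨c, hc, hcA, ?_⟩
        simp only [mem_insert, mem_range] at hc
        omega
    · obtain ⟨i, hi, rfl⟩ := mem_image.1 hL
      simp only [mem_insert, mem_range, not_or] at haL
      exact ⟨b, mem_insert_of_mem (mem_range.2 hb), hbA, by omega⟩

end ColexBound

/-! ### The case of five vertices, sorting of weights, and the conclusion. -/

section Main

/-- Without the quadruple the value is y₄ e₂(y₀, …, y₃) ≤ (3/8)(1 - u)u² ≤ 1/18, where u = y₀ + y₁ +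
y₂ + y₃. The weights 0, 1/4, 1/4, 1/4, 1/4 make the paw weightless and give 1/16. -/
theorem exists_pawMissing_ge_quadMissing_five {y : ℕ → ℝ} (hy : ∀ i < 5, 0 ≤ y i)
    (hsum : ∑ i ∈ range 5, y i = 1) :
    ∃ y' : ℕ → ℝ, (∀ i < 5, 0 ≤ y' i) ∧ ∑ i ∈ range 5, y' i = 1 ∧
      elemSymm (range 5) 3 y - quadMissing 0 y ≤ elemSymm (range 5) 3 y' - pawMissing 1 y' := by
  have hsymm : ∀ f : ℕ → ℝ, elemSymm (range 5) 3 f =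
      f 0 * f 1 * f 2 + f 0 * f 1 * f 3 + f 0 * f 2 * f 3 + f 1 * f 2 * f 3 +
        f 4 * (f 0 * f 1 + f 0 * f 2 + f 0 * f 3 + f 1 * f 2 + f 1 * f 3 + f 2 * f 3) := by
    intro f
    rw [← coeff_prod_linFactor]
    simp only [prod_range_succ, prod_range_zero, coeff_mul_linFactor, Polynomial.coeff_one]
    simp [linFactor, Polynomial.coeff_zero_eq_eval_zero]
    ring
  refine ⟨fun i => if i = 0 then 0 else 1 / 4, fun i _ => ?_, ?_, ?_⟩
  · dsimp only
    split_ifs <;> norm_num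
  · norm_num [sum_range_succ]
  · rw [hsymm, hsymm]
    norm_num [quadMissing, pawMissing]
    simp only [sum_range_succ, sum_range_zero, zero_add] at hsum
    have hz : y 4 = 1 - (y 0 + y 1 + y 2 + y 3) := by linarith
    set u := y 0 + y 1 + y 2 + y 3 with hu
    have hz0 := hy 4 (by norm_num)
    have hu0 : 0 ≤ u := by
      have := hy 0 (by norm_num); have := hy 1 (by norm_num)
      have := hy 2 (by norm_num); have := hy 3 (by norm_num)
      positivity
    have he2 : y 0 * y 1 + y 0 * y 2 + y 0 * y 3 + y 1 * y 2 + y 1 * y 3 + y 2 * y 3 ≤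
        3 / 8 * u ^ 2 := by
      rw [hu]
      nlinarith [sq_nonneg (y 0 - y 1), sq_nonneg (y 0 - y 2), sq_nonneg (y 0 - y 3),
        sq_nonneg (y 1 - y 2), sq_nonneg (y 1 - y 3), sq_nonneg (y 2 - y 3)]
    have h1 := mul_le_mul_of_nonneg_left he2 hz0
    have h2 : y 4 * (3 / 8 * u ^ 2) ≤ 1 / 18 := by
      rw [hz]
      -- 4/27 - u²(1 - u) = (u + 1/3)(u - 2/3)².
      nlinarith [mul_nonneg (by linarith : 0 ≤ u + 1 / 3) (sq_nonneg (u - 2 / 3))]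
    linarith

/-- Relabelling the vertices by increasing weight. -/
theorem exists_sortedWeights {α : Type*} {r t : ℕ} (G : RGraph α r) (hV : G.verts.card = t)
    {x : α → ℝ} (hx : G.IsLegal x) :
    ∃ (y : ℕ → ℝ) (E : Finset (Finset ℕ)), SortedWeights t y ∧ ∑ i ∈ range t, y i = 1 ∧
      E ⊆ (range t).powersetCard r ∧ E.card = G.edges.card ∧
      ∑ A ∈ E, ∏ i ∈ A, y i = G.lagrangePoly x := by
  classical
  let e₀ : Fin t ≃ G.verts := (finCongr hV.symm).trans G.verts.equivFin.symm
  let f : Fin t → ℝ := fun i => x (e₀ i)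
  let e : Fin t ≃ G.verts := (Tuple.sort f).trans e₀
  have hmono : Monotone fun i => x (e i) := Tuple.monotone_sort f
  let y : ℕ → ℝ := fun i => if h : i < t then x (e ⟨i, h⟩) else 0
  have hyi : ∀ i : Fin t, y i = x (e i) := fun i => dif_pos i.2
  let ι : α → ℕ := fun a => if h : a ∈ G.verts then (e.symm ⟨a, h⟩ : ℕ) else 0
  have hι : ∀ a (h : a ∈ G.verts), ι a = e.symm ⟨a, h⟩ := fun a h => dif_pos h
  have hιlt : ∀ a ∈ G.verts, ι a < t := fun a h => by rw [hι a h]; exact (e.symm _).2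
  have hyι : ∀ a ∈ G.verts, y (ι a) = x a := fun a h => by
    rw [hι a h, hyi, Equiv.apply_symm_apply]
  have hinj : Set.InjOn ι (G.verts : Set α) := by
    intro a ha b hb hab
    rw [hι a ha, hι b hb, Fin.val_inj, e.symm.injective.eq_iff, Subtype.mk.injEq] at hab
    exact hab
  have hE : ∀ A ∈ G.edges, A ⊆ G.verts ∧ A.card = r := fun A hA =>
    mem_powersetCard.1 (G.edges_subset hA)
  have hinjE : Set.InjOn (image ι) (G.edges : Set (Finset α)) := by
    intro A hA B hB hAB
    have key : ∀ S T : Finset α, S ⊆ G.verts → T ⊆ G.verts → image ι S = image ι T → S ⊆ T := by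
      intro S T hS hT h a ha
      obtain ⟨b, hb, hba⟩ := mem_image.1 (h ▸ mem_image_of_mem ι ha : ι a ∈ image ι T)
      exact hinj (hT hb) (hS ha) hba ▸ hb
    exact (key A B (hE A hA).1 (hE B hB).1 hAB).antisymm (key B A (hE B hB).1 (hE A hA).1 hAB.symm)
  refine ⟨y, G.edges.image (image ι), ⟨fun i hi => ?_, fun i j hij hj => ?_⟩, ?_, fun A hA => ?_,
    card_image_of_injOn hinjE, ?_⟩
  · rw [hyi ⟨i, hi⟩]
    exact hx.1 _ (e _).2
  · rw [hyi ⟨i, by omega⟩, hyi ⟨j, hj⟩]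
    exact hmono (Fin.mk_le_mk.2 hij)
  · rw [← hx.2, ← Fin.sum_univ_eq_sum_range, ← sum_coe_sort G.verts]
    simp only [hyi]
    exact Equiv.sum_comp e fun a => x a
  · obtain ⟨B, hB, rfl⟩ := mem_image.1 hA
    rw [mem_powersetCard, card_image_of_injOn (hinj.mono (coe_subset.2 (hE B hB).1))]
    refine ⟨fun i hi => ?_, (hE B hB).2⟩
    obtain ⟨a, ha, rfl⟩ := mem_image.1 hi
    exact mem_range.2 (hιlt a ((hE B hB).1 ha))
  · rw [sum_image hinjE]
    refine sum_congr rfl fun A hA => ?_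
    rw [prod_image (hinj.mono (coe_subset.2 (hE A hA).1))]
    exact prod_congr rfl fun a ha => hyι a ((hE A hA).1 ha)

theorem theorem1p9 {α : Type*} (r m t : ℕ) (hr : 1 ≤ r) (hm : 1 ≤ m)
    (hmt : m + 4 = t.choose r) (ht : t = r + 2 → r ≤ 3) :
    ((colexGraph r m t (by omega)).verts.card = t ∧
      (colexGraph r m t (by omega)).edges.card = m) ∧
    ∀ G : RGraph α r, G.verts.card = t → G.edges.card = m →
      G.lagrangian ≤ (colexGraph r m t (by omega)).lagrangian := by
  refine ⟨⟨by simp [colexGraph], colexGraph_card_edges r m t _⟩, fun G hV hGm => ?_⟩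
  have htpos : 0 < t := by
    by_contra hcon
    obtain rfl : t = 0 := by omega
    rw [Nat.choose_eq_zero_of_lt hr] at hmt
    omega
  obtain ⟨x, hx, hxl⟩ := (G.isGreatest_lagrangian (card_pos.1 (hV ▸ htpos))).1
  obtain ⟨y, E, hy, hsum, hEt, hEc, hEs⟩ := exists_sortedWeights G hV hx
  have hF : ((range t).powersetCard r \ E).card = 4 := by
    rw [card_sdiff_of_subset hEt, hEc, card_powersetCard, card_range]
    omega
  have hval : G.lagrangian = elemSymm (range t) r y -
      ∑ A ∈ (range t).powersetCard r \ E, ∏ i ∈ A, y i := by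
    rw [← hxl, ← hEs, elemSymm, ← sum_sdiff hEt, add_sub_cancel_left]
  rw [hval]
  rcases hy.missing_le hr sdiff_subset hF with ⟨k, rfl, hk, hle⟩ | ⟨k, rfl, hk, hle⟩ |
    ⟨k, rfl, hk, hle⟩ <;> refine (sub_le_sub_left hle _).trans ?_
  · exact elemSymm_sub_starMissing_le hmt _ hk hy.1 hsum
  · rcases hk.eq_or_lt with rfl | hk
    · exact elemSymm_sub_pawMissing_le hmt _ hy.1 hsum
    · obtain ⟨y', h0, h1, h2⟩ : ∃ y' : ℕ → ℝ, (∀ i < t, 0 ≤ y' i) ∧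
          ∑ i ∈ range t, y' i = ∑ i ∈ range t, y i ∧
          elemSymm (range t) (k + 2) y - pawMissing k y ≤
            elemSymm (range t) (k + 2) y' - starMissing (k + 1) y' := by
        rcases k with _ | n
        · exact exists_starMissing_ge_pawMissing_two (by omega) hy.1
        · exact exists_starMissing_ge_pawMissing (by omega) hy.1
      exact h2.trans (elemSymm_sub_starMissing_le hmt _ (by omega) h0 (h1.trans hsum))
  · rcases hk.eq_or_lt with rfl | hk
    · exact elemSymm_sub_quadMissing_le hmt _ hy.1 hsum
    · rcases Nat.eq_or_lt_of_le (Nat.succ_le_of_lt hk) with h5 | hk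
      -- Here t = r + 2, and `ht` leaves only r = 3.
      · obtain rfl : k = 0 := by omega
        obtain rfl : t = 5 := by omega
        obtain ⟨y', h0, h1, h2⟩ := exists_pawMissing_ge_quadMissing_five hy.1 hsum
        exact h2.trans (elemSymm_sub_pawMissing_le (k := 1) hmt _ h0 h1)
      · obtain ⟨y', h0, h1, h2⟩ := exists_starMissing_ge_quadMissing (n := k) (by omega) hy.1
        exact h2.trans (elemSymm_sub_starMissing_le hmt _ (by omega) h0 (h1.trans hsum))

end Main
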